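/- Theorem 4.4 (formula for an equivalent 0-minimal pair). Let $\vartheta\in(0,\pi/2]$ and let $V\subset\mathbb{R}^2$ be the closed convex angle with apex $0$ and measure $\pi-2\vartheta$ that is bisected by the negative part of the $x$-axis (a ray if $\vartheta=\pi/2$). Let $\mathcal{C}_V(\mathbb{R}^2)$ be the family of all nonempty closed convex sets $A\subset\mathbb{R}^2$ whose recession cone $\{x : x+A\subset A\}$ equals $V$. For $A,B\in\mathcal{C}_V(\mathbb{R}^2)$ let $[A,B]$ be the set of all pairs $(C,D)$ of members of $\mathcal{C}_V(\mathbb{R}^2)$ with $\mathrm{cl}(A+D)=\mathrm{cl}(B+C)$. The pair $(A,B)$ is called 0-minimal if it is a minimal element, with respect to componentwise inclusion, of $\{(C,D)\in[A,B] : 0\in D\}$. For $A\in\mathcal{C}_V(\mathbb{R}^2)$ and $t\in(-\vartheta,\vartheta)$ let $H_A(t)$ be the center of the support set $\{a\in A : \langle a,u\rangle=\max_{b\in A}\langle b,u\rangle\}$, $u=(\cos t,\sin t)$, which is a segment or a singleton. Let $f_A(t)$ be the length of the arc of the boundary of $A$ joining $H_A(0)$ and $H_A(t)$ if $t\ge 0$,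 and minus that length if $t<0$. For a function $f:(-\vartheta,\vartheta)\to\mathbb{R}$ that is non-decreasing and satisfies $$f(0)=0,\qquad f(t)=\tfrac12\bigl(f(t^+)+f(t^-)\bigr)\ \text{ for } t\in(-\vartheta,\vartheta),\qquad(**)$$ put, with Riemann–Stieltjes integrals, $H_f(t)=\int_0^t(-\sin s,\cos s)\,df(s)$ for $t\ge0$ and $H_f(t)=-\int_t^0(-\sin s,\cos s)\,df(s)$ for $t<0$, and let $A_f=\mathrm{cl}\,\mathrm{conv}(\mathrm{im}\,H_f)+V$. Order the non-decreasing functions on $(-\vartheta,\vartheta)$ with value $0$ at $0$ by letting $f$ precede $g$ if and only if $g-f$ is non-decreasing. Then for all $A,B\in\mathcal{C}_V(\mathbb{R}^2)$ the infimum $\inf(f_A,f_B)$ with respect to this ordering exists, the functions $g_A=f_A-\inf(f_A,f_B)$ and $g_B=f_B-\inf(f_A,f_B)$ are non-decreasing and satisfy $(**)$, and the pair $(A_{g_A}+H_A(0)-H_B(0),\,A_{g_B})$ is 0-minimal and belongs to $[A,B]$. -/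

import Mathlib

open Set Filter Topology
open scoped Pointwise

namespace PlanarPairs

/-- The Euclidean plane. -/
abbrev Plane : Type := EuclideanSpace ℝ (Fin 2)

/-! ### Convex sets sharing a recession cone, and equivalence of pairs -/

/-- The recession cone `recc A = {x | x + A ⊆ A}`. -/
def recc (A : Set Plane) : Set Plane := {x | ∀ a ∈ A, x + a ∈ A}

/-- The family `C_V(ℝ²)` of nonempty closed convex sets with recession cone `V`. -/
def CV (V : Set Plane) : Set (Set Plane) :=
  {A | A.Nonempty ∧ IsClosed A ∧ Convex ℝ A ∧ recc A = V}

/-- The quotient class `[A, B]`: all pairs `(C, D)` of members of `C_V(ℝ²)` such that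
`cl (A + D) = cl (B + C)`. -/
def quotClass (V : Set Plane) (A B : Set Plane) : Set (Set Plane × Set Plane) :=
  {P | P.1 ∈ CV V ∧ P.2 ∈ CV V ∧ closure (A + P.2) = closure (B + P.1)}

/-- `(A, B)` is 0-minimal: it is a minimal element, for componentwise inclusion, of
`{(C, D) ∈ [A, B] | 0 ∈ D}`. -/
def IsZeroMinimal (V : Set Plane) (A B : Set Plane) : Prop :=
  Minimal (fun P : Set Plane × Set Plane => P ∈ quotClass V A B ∧ (0 : Plane) ∈ P.2) (A, B)

/-! ### The cone -/

/-- The closed convex angle with apex `0` and measure `π - 2ϑ` which is bisected by the negative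
part of the `x`-axis, for `0 < ϑ ≤ π / 2` (for `ϑ = π / 2` it is the ray itself). -/
def sector (ϑ : ℝ) : Set Plane :=
  {x | x 0 ≤ 0 ∧ |x 1| * Real.sin ϑ ≤ -x 0 * Real.cos ϑ}

/-! ### The boundary function and the arc-length function of a set -/

/-- The unit vector `(cos t, sin t)`. -/
noncomputable def dir (t : ℝ) : Plane := !₂[Real.cos t, Real.sin t]

/-- The unit vector `(-sin t, cos t)`. -/
noncomputable def tang (t : ℝ) : Plane := !₂[-Real.sin t, Real.cos t]

/-- The support set `A(u)`, the set of all points of `A` that maximize `⟨u, ·⟩` over `A`. -/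
def supportSet (A : Set Plane) (u : Plane) : Set Plane :=
  {a | a ∈ A ∧ ∀ b ∈ A, inner ℝ u b ≤ inner ℝ u a}

open Classical in
/-- The center of a segment (or singleton); the value is `0` for sets of any other shape. -/
noncomputable def segCenter (S : Set Plane) : Plane :=
  if h : ∃ c, ∃ a b : Plane, S = segment ℝ a b ∧ c = midpoint ℝ a b then h.choose else 0

/-- The boundary function `H_A`: `H_A(t)` is the center of `A(cos t, sin t)`. -/
noncomputable def bdryFun (A : Set Plane) (t : ℝ) : Plane := segCenter (supportSet A (dir t))

/-- The right-hand boundary curve of `A`, parametrized by the second coordinate: `y` is sent to the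
point of `A` on the horizontal line at height `y` that has the largest first coordinate. -/
noncomputable def bdryCurve (A : Set Plane) (y : ℝ) : Plane :=
  !₂[sSup {x : ℝ | (!₂[x, y] : Plane) ∈ A}, y]

/-- The length (supremum of the lengths of inscribed polygonal lines) of the arc of the boundary
curve of `A` between the heights `y₁ ≤ y₂`. -/
noncomputable def arcLength (A : Set Plane) (y₁ y₂ : ℝ) : ℝ :=
  (eVariationOn (bdryCurve A) (Icc y₁ y₂)).toReal

/-- The arc-length function `f_A` of a set `A` with recession cone `sector ϑ`, meaningful on
`(-ϑ, ϑ)`: for `t ≥ 0` the length of the boundary arc joining `H_A(0)` and `H_A(t)`, for `t < 0`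
minus that length. As `A` recedes in the direction `(-1, 0)` and `(cos t, sin t)` has a positive
first coordinate, that arc is the part of the right-hand boundary curve between the heights of its
two end points. -/
noncomputable def arcFun (A : Set Plane) (t : ℝ) : ℝ :=
  if 0 ≤ t then arcLength A (bdryFun A 0 1) (bdryFun A t 1)
  else -arcLength A (bdryFun A t 1) (bdryFun A 0 1)

/-! ### The set generated by a non-decreasing function -/

/-- `I` is the Riemann–Stieltjes integral `∫_a^b g df`, the limit of the sums
`∑ (f(x_{i+1}) - f(x_i)) g(ξ_i)` over tagged partitions of `[a, b]` whose mesh tends to `0`. -/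
def HasStieltjesIntegral (g : ℝ → Plane) (f : ℝ → ℝ) (a b : ℝ) (I : Plane) : Prop :=
  ∀ ε : ℝ, 0 < ε → ∃ δ : ℝ, 0 < δ ∧ ∀ (n : ℕ) (x ξ : ℕ → ℝ), x 0 = a → x n = b →
    (∀ i < n, x i ≤ ξ i ∧ ξ i ≤ x (i + 1) ∧ x (i + 1) - x i < δ) →
    ‖(∑ i ∈ Finset.range n, (f (x (i + 1)) - f (x i)) • g (ξ i)) - I‖ < ε

open Classical in
/-- The Riemann–Stieltjes integral `∫_a^b g df` (`0` if it does not exist). -/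
noncomputable def stieltjesIntegral (g : ℝ → Plane) (f : ℝ → ℝ) (a b : ℝ) : Plane :=
  if h : ∃ I, HasStieltjesIntegral g f a b I then h.choose else 0

/-- The function `H_f`. -/
noncomputable def genFun (f : ℝ → ℝ) (t : ℝ) : Plane :=
  if 0 ≤ t then stieltjesIntegral tang f 0 t else -stieltjesIntegral tang f t 0

/-- The set `A_f = cl conv (im H_f) + V`, where `H_f` is considered on `(-ϑ, ϑ)` and
`V = sector ϑ`. -/
noncomputable def genSet (ϑ : ℝ) (f : ℝ → ℝ) : Set Plane :=
  closure (convexHull ℝ (genFun f '' Ioo (-ϑ) ϑ)) + sector ϑ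

/-! ### Non-decreasing functions, their ordering and infima -/

/-- `f` is non-decreasing on `(-ϑ, ϑ)` and `f 0 = 0`. -/
def IsNondecr (ϑ : ℝ) (f : ℝ → ℝ) : Prop := MonotoneOn f (Ioo (-ϑ) ϑ) ∧ f 0 = 0

/-- `f t = (f(t⁺) + f(t⁻)) / 2` for all `t ∈ (-ϑ, ϑ)`. -/
def IsMidvalued (ϑ : ℝ) (f : ℝ → ℝ) : Prop :=
  ∀ t ∈ Ioo (-ϑ) ϑ, ∃ r l : ℝ, Tendsto f (𝓝[>] t) (𝓝 r) ∧ Tendsto f (𝓝[<] t) (𝓝 l) ∧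
    f t = (r + l) / 2

/-- `f` precedes `g`: the difference `g - f` is non-decreasing on `(-ϑ, ϑ)`. -/
def Precedes (ϑ : ℝ) (f g : ℝ → ℝ) : Prop := MonotoneOn (fun t => g t - f t) (Ioo (-ϑ) ϑ)

/-- `h` is (on `(-ϑ, ϑ)`) the infimum `inf(f, g)` of `f` and `g` with respect to the ordering
`Precedes` of the non-decreasing functions vanishing at `0`. -/
def IsInfimum (ϑ : ℝ) (f g h : ℝ → ℝ) : Prop :=
  (IsNondecr ϑ h ∧ Precedes ϑ h f ∧ Precedes ϑ h g) ∧
    ∀ k : ℝ → ℝ, IsNondecr ϑ k → Precedes ϑ k f → Precedes ϑ k g → Precedes ϑ k h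

end PlanarPairs

namespace PlanarPairs

/-! ### Coordinates -/

/-! A member `A` of the family is the intersection of its supporting half-planes with normals `dir
t`, `t ∈ (-ϑ, ϑ)` (`mem_of_forall_inner_dir_le`), so it is determined by its boundary function. That
function satisfies `dH = tang df` with `f` the arc length (`tangentialOn_bdryFun`), a relation
encoded by `TangentialOn` as an estimate on increments. By `eq_of_norm_sub_le` such an estimate lets
`f` determine the increments of `H` and conversely; hence `H_A = H_A(0) + H_{f_A}`. Boundary
functions add under Minkowski sums (`bdryFun_add`), and therefore so do arc-length functions. Thus
`(C, D) ∈ [A, B]` forces `f_A + f_D = f_B + f_C`.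

The infimum is `(f_A + f_B - v) / 2`, where `v` is the signed variation of `f_A - f_B`. So `g_A -
g_B` is the Jordan decomposition of `f_A - f_B`, the smallest way to write it as a difference of
non-decreasing functions. For every competitor `(C, D)` the function `p = f_D - g_B` is consequently
non-decreasing (`IsInfimum.monotoneOn_sub`).

Minimality follows because `H_D = w + H_{g_B} + H_p` with `w = H_D(0)`. The inclusion `D ⊆ A_{g_B}`
gives `⟨u, w + H_p⟩ ≤ 0` in each direction `u`, whereas `⟨u, H_p⟩ ≥ 0` since the curve `H_p` passes
through `0`. With `0 ∈ D` this yields `w = 0`, so the support functions of `D` and `A_{g_B}` agree,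
and the balance equation settles the first components. -/

lemma inner_dir (t : ℝ) (x : Plane) :
    inner ℝ (dir t) x = Real.cos t * x 0 + Real.sin t * x 1 := by
  simp [dir, PiLp.inner_apply, Fin.sum_univ_two, mul_comm]

lemma inner_tang (t : ℝ) (x : Plane) :
    inner ℝ (tang t) x = -Real.sin t * x 0 + Real.cos t * x 1 := by
  simp [tang, PiLp.inner_apply, Fin.sum_univ_two, mul_comm]

lemma inner_dir_tang (t s : ℝ) : inner ℝ (dir t) (tang s) = Real.sin (t - s) := by
  rw [inner_dir, Real.sin_sub]; simp [tang]; ring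

lemma inner_dir_zero (x : Plane) : inner ℝ (dir 0) x = x 0 := by simp [inner_dir]

lemma norm_sq_plane (x : Plane) : ‖x‖ ^ 2 = x 0 ^ 2 + x 1 ^ 2 := by
  simp [EuclideanSpace.real_norm_sq_eq, Fin.sum_univ_two]

lemma norm_le_abs_add (x : Plane) : ‖x‖ ≤ |x 0| + |x 1| := by
  refine abs_le_of_sq_le_sq' ?_ (by positivity) |>.2
  rw [norm_sq_plane, add_sq, sq_abs, sq_abs]
  nlinarith [abs_nonneg (x 0), abs_nonneg (x 1), mul_nonneg (abs_nonneg (x 0)) (abs_nonneg (x 1))]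

lemma norm_dir (t : ℝ) : ‖dir t‖ = 1 := by
  have h := norm_sq_plane (dir t)
  simp only [dir, PiLp.toLp_apply, Matrix.cons_val_zero, Matrix.cons_val_one,
    Real.cos_sq_add_sin_sq] at h
  exact (pow_eq_one_iff_of_nonneg (norm_nonneg _) two_ne_zero).1 h

lemma norm_tang (t : ℝ) : ‖tang t‖ = 1 := by
  have h := norm_sq_plane (tang t)
  simp only [tang, PiLp.toLp_apply, Matrix.cons_val_zero, Matrix.cons_val_one, neg_sq,
    Real.sin_sq_add_cos_sq] at h
  exact (pow_eq_one_iff_of_nonneg (norm_nonneg _) two_ne_zero).1 h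

lemma norm_tang_sub_le (t s : ℝ) : ‖tang t - tang s‖ ≤ |t - s| := by
  refine abs_le_of_sq_le_sq' ?_ (abs_nonneg _) |>.2
  rw [norm_sq_plane, sq_abs]
  have h := Real.one_sub_sq_div_two_le_cos (x := t - s)
  rw [Real.cos_sub] at h
  simp only [tang, PiLp.sub_apply, Matrix.cons_val_zero, Matrix.cons_val_one]
  nlinarith [Real.sin_sq_add_cos_sq t, Real.sin_sq_add_cos_sq s]

lemma continuous_dir : Continuous dir := by
  unfold dir
  refine (PiLp.continuous_toLp 2 _).comp (continuous_pi fun i => ?_)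
  fin_cases i <;> simp <;> fun_prop

lemma continuous_tang : Continuous tang := by
  unfold tang
  refine (PiLp.continuous_toLp 2 _).comp (continuous_pi fun i => ?_)
  fin_cases i <;> simp <;> fun_prop

lemma plane_ext {x y : Plane} (h0 : x 0 = y 0) (h1 : x 1 = y 1) : x = y := by
  ext i; fin_cases i <;> assumption

/-- A vector is determined by its components along `dir t` and `tang t`. -/
lemma eq_zero_of_inner_dir_tang {t : ℝ} {x : Plane} (h0 : inner ℝ (dir t) x = 0)
    (h1 : inner ℝ (tang t) x = 0) : x = 0 := by
  rw [inner_dir] at h0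
  rw [inner_tang] at h1
  have := Real.sin_sq_add_cos_sq t
  refine plane_ext ?_ ?_ <;> simp only [PiLp.zero_apply]
  · linear_combination Real.cos t * h0 - Real.sin t * h1 - x 0 * this
  · linear_combination Real.sin t * h0 + Real.cos t * h1 - x 1 * this

/-! ### The sector -/

section Sector
variable {ϑ : ℝ}

lemma cos_pos_of_mem (hϑ' : ϑ ≤ Real.pi / 2) {t : ℝ} (ht : t ∈ Ioo (-ϑ) ϑ) : 0 < Real.cos t :=
  Real.cos_pos_of_mem_Ioo ⟨by linarith [ht.1], by linarith [ht.2]⟩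

lemma sin_sub_pos (hϑ' : ϑ ≤ Real.pi / 2) {s t : ℝ} (hs : s ∈ Ioo (-ϑ) ϑ) (ht : t ∈ Ioo (-ϑ) ϑ)
    (hst : s < t) : 0 < Real.sin (t - s) :=
  Real.sin_pos_of_pos_of_lt_pi (by linarith) (by linarith [ht.2, hs.1])

lemma zero_mem_Ioo (hϑ : 0 < ϑ) : (0 : ℝ) ∈ Ioo (-ϑ) ϑ := ⟨by linarith, hϑ⟩

/-- The sector is the polar cone of the directions `dir t`, `t ∈ (-ϑ, ϑ)`. -/
lemma mem_sector_iff (hϑ : 0 < ϑ) (hϑ' : ϑ ≤ Real.pi / 2) {w : Plane} :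
    w ∈ sector ϑ ↔ ∀ t ∈ Ioo (-ϑ) ϑ, inner ℝ (dir t) w ≤ 0 := by
  constructor
  · rintro ⟨h0, h1⟩ t ht
    rw [inner_dir]
    have hs := Real.sin_pos_of_pos_of_lt_pi hϑ (by linarith [Real.pi_pos])
    have hc : 0 < Real.cos t := cos_pos_of_mem hϑ' ht
    have hp := Real.sin_pos_of_pos_of_lt_pi (x := ϑ - t) (by linarith [ht.2]) (by linarith [ht.1])
    have hq := Real.sin_pos_of_pos_of_lt_pi (x := ϑ + t) (by linarith [ht.1]) (by linarith [ht.2])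
    rw [Real.sin_sub] at hp
    rw [Real.sin_add] at hq
    have key : |Real.sin t| * Real.cos ϑ ≤ Real.cos t * Real.sin ϑ := by
      rcases abs_cases (Real.sin t) with h | h <;> rw [h.1] <;> nlinarith
    have h2 : Real.sin t * w 1 ≤ |Real.sin t| * |w 1| := by
      rw [← abs_mul]; exact le_abs_self _
    have h3 : Real.sin ϑ * (Real.cos t * w 0 + |Real.sin t| * |w 1|) ≤ 0 := by
      have := mul_le_mul_of_nonneg_left h1 (abs_nonneg (Real.sin t))
      nlinarith
    nlinarith
  · intro h
    -- The edges of the sector have normals `dir (±ϑ)`, outside the open interval but reached by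
    -- continuity.
    have hcl : ∀ t ∈ Icc (-ϑ) ϑ, inner ℝ (dir t) w ≤ 0 := by
      intro t ht
      rw [← closure_Ioo (by linarith : (-ϑ : ℝ) ≠ ϑ)] at ht
      have hc : IsClosed {t : ℝ | inner ℝ (dir t) w ≤ 0} :=
        isClosed_le (continuous_dir.inner continuous_const) continuous_const
      exact closure_minimal h hc ht
    have h1 := hcl ϑ ⟨by linarith, le_rfl⟩
    have h2 := hcl (-ϑ) ⟨le_rfl, by linarith⟩
    have h3 := hcl 0 ⟨by linarith, hϑ.le⟩
    simp only [inner_dir, Real.cos_neg, Real.sin_neg, Real.cos_zero, Real.sin_zero] at h1 h2 h3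
    refine ⟨by linarith, ?_⟩
    rcases abs_cases (w 1) with h | h <;> rw [h.1] <;> linarith

lemma isClosed_sector : IsClosed (sector ϑ) := by
  have h0 : Continuous fun x : Plane => x 0 := by fun_prop
  have h1 : Continuous fun x : Plane => x 1 := by fun_prop
  exact (isClosed_le h0 continuous_const).inter
    (isClosed_le (h1.abs.mul continuous_const) (h0.neg.mul continuous_const))

lemma zero_mem_sector : (0 : Plane) ∈ sector ϑ := by simp [sector]

lemma add_mem_sector (hϑ : 0 < ϑ) (hϑ' : ϑ ≤ Real.pi / 2) {v w : Plane} (hv : v ∈ sector ϑ)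
    (hw : w ∈ sector ϑ) : v + w ∈ sector ϑ := by
  rw [mem_sector_iff hϑ hϑ'] at *
  intro t ht
  rw [inner_add_right]
  linarith [hv t ht, hw t ht]

lemma smul_mem_sector {v : Plane} (hv : v ∈ sector ϑ) {c : ℝ} (hc : 0 ≤ c) :
    c • v ∈ sector ϑ := by
  refine ⟨mul_nonpos_of_nonneg_of_nonpos hc hv.1, ?_⟩
  have := mul_le_mul_of_nonneg_left hv.2 hc
  simp only [PiLp.smul_apply, smul_eq_mul, abs_mul, abs_of_nonneg hc]
  linarith

lemma convex_sector (hϑ : 0 < ϑ) (hϑ' : ϑ ≤ Real.pi / 2) : Convex ℝ (sector ϑ) :=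
  fun _ hv _ hw _ _ ha hb _ =>
    add_mem_sector hϑ hϑ' (smul_mem_sector hv ha) (smul_mem_sector hw hb)

/-- If the product vanished at `t`, then `t` would be an interior maximum of `r ↦ ⟨dir r, w⟩ ≤ 0`,
so the derivative `⟨tang t, w⟩` would vanish as well, forcing `w = 0`. -/
lemma inner_dir_neg_of_mem_sector (hϑ : 0 < ϑ) (hϑ' : ϑ ≤ Real.pi / 2) {w : Plane}
    (hw : w ∈ sector ϑ) (hw0 : w ≠ 0) {t : ℝ} (ht : t ∈ Ioo (-ϑ) ϑ) : inner ℝ (dir t) w < 0 := by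
  rw [mem_sector_iff hϑ hϑ'] at hw
  refine lt_of_le_of_ne (hw t ht) fun h0 => hw0 ?_
  refine eq_zero_of_inner_dir_tang h0 ?_
  have hd : HasDerivAt (fun r => inner ℝ (dir r) w) (inner ℝ (tang t) w) t := by
    have := ((Real.hasDerivAt_cos t).mul_const (w 0)).add ((Real.hasDerivAt_sin t).mul_const (w 1))
    rw [inner_tang]
    exact this.congr_of_eventuallyEq (Eventually.of_forall fun r => inner_dir r w)
  refine IsLocalMax.hasDerivAt_eq_zero ?_ hd
  filter_upwards [Ioo_mem_nhds ht.1 ht.2] with r hr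
  rw [h0]
  exact hw r hr

/-! ### Sets that are bounded above in two symmetric directions -/

/-- `X` lies in a translate of a sector symmetric with respect to the first axis. -/
def SectorBounded (τ : ℝ) (X : Set Plane) : Prop :=
  ∃ M : ℝ, ∀ x ∈ X, x 0 * Real.cos τ + |x 1| * Real.sin τ ≤ M

lemma sectorBounded_of_le {τ : ℝ} {X : Set Plane} {a b : ℝ}
    (ha : ∀ x ∈ X, inner ℝ (dir τ) x ≤ a) (hb : ∀ x ∈ X, inner ℝ (dir (-τ)) x ≤ b) :
    SectorBounded τ X := by
  refine ⟨max a b, fun x hx => ?_⟩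
  have h1 := ha x hx
  have h2 := hb x hx
  simp only [inner_dir, Real.cos_neg, Real.sin_neg] at h1 h2
  rcases abs_cases (x 1) with h | h <;> rw [h.1]
  · linarith [le_max_left a b]
  · linarith [le_max_right a b]

/-- The defining inequality bounds `x 0` from above because `cos τ > 0`; a lower bound on `x 0` then
bounds `|x 1|` because `sin τ > 0`. -/
lemma SectorBounded.isBounded {τ : ℝ} (hτ : 0 < τ) (hτ' : τ < Real.pi / 2) {X : Set Plane}
    (hX : SectorBounded τ X) (c : ℝ) : Bornology.IsBounded {x ∈ X | c ≤ x 0} := by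
  obtain ⟨M, hM⟩ := hX
  have hc : 0 < Real.cos τ := Real.cos_pos_of_mem_Ioo ⟨by linarith, hτ'⟩
  have hs : 0 < Real.sin τ := Real.sin_pos_of_pos_of_lt_pi hτ (by linarith)
  rw [isBounded_iff_forall_norm_le]
  refine ⟨|c| + |M / Real.cos τ| + (M - c * Real.cos τ) / Real.sin τ, fun x ⟨hx, hcx⟩ => ?_⟩
  have h := hM x hx
  have h1 : |x 1| ≤ (M - c * Real.cos τ) / Real.sin τ := by
    rw [le_div_iff₀ hs]; nlinarith
  have h0 : x 0 ≤ M / Real.cos τ := by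
    rw [le_div_iff₀ hc]; nlinarith [mul_nonneg (abs_nonneg (x 1)) hs.le]
  have h2 : |x 0| ≤ |c| + |M / Real.cos τ| := by
    rw [abs_le]
    constructor
    · linarith [neg_abs_le c, abs_nonneg (M / Real.cos τ)]
    · linarith [le_abs_self (M / Real.cos τ), abs_nonneg c]
  linarith [norm_le_abs_add x]

/-- If `x n + y n` converges, the upper bound on `y n 0` bounds `x n 0` from below, so `x n` has a
convergent subsequence. This makes the closures in `quotClass` harmless. -/
lemma SectorBounded.isClosed_add {τ : ℝ} (hτ : 0 < τ) (hτ' : τ < Real.pi / 2) {X Y : Set Plane}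
    (hX : SectorBounded τ X) (hY : SectorBounded τ Y) (hXc : IsClosed X) (hYc : IsClosed Y) :
    IsClosed (X + Y) := by
  have hc : 0 < Real.cos τ := Real.cos_pos_of_mem_Ioo ⟨by linarith, hτ'⟩
  have hs : 0 < Real.sin τ := Real.sin_pos_of_pos_of_lt_pi hτ (by linarith)
  refine IsSeqClosed.isClosed fun z z₀ hz hlim => ?_
  choose x hx y hy hxy using hz
  obtain ⟨N, hN⟩ := hY
  have hz0 : Tendsto (fun n => z n 0) atTop (𝓝 (z₀ 0)) :=
    ((by fun_prop : Continuous fun p : Plane => p 0).tendsto z₀).comp hlim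
  obtain ⟨m, hm⟩ := hz0.bddBelow_range
  have hb : ∀ n, x n ∈ {x ∈ X | m - N / Real.cos τ ≤ x 0} := by
    refine fun n => ⟨hx n, ?_⟩
    have h1 : m ≤ z n 0 := hm ⟨n, rfl⟩
    have h2 : y n 0 ≤ N / Real.cos τ := by
      rw [le_div_iff₀ hc]; nlinarith [hN _ (hy n), mul_nonneg (abs_nonneg (y n 1)) hs.le]
    have h3 : x n 0 + y n 0 = z n 0 := by rw [← hxy n]; rfl
    linarith
  obtain ⟨a, -, φ, hφ, ha⟩ := tendsto_subseq_of_bounded (hX.isBounded hτ hτ' _) hb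
  refine ⟨a, hXc.mem_of_tendsto ha (Eventually.of_forall fun n => hx _), z₀ - a, ?_, by simp⟩
  refine hYc.mem_of_tendsto ((hlim.comp hφ.tendsto_atTop).sub ha) (Eventually.of_forall fun n => ?_)
  simp only [Function.comp_apply, ← hxy (φ n), add_sub_cancel_left]
  exact hy _

/-! ### Boundedness of the members of `C_V` -/

/-- The convex combinations of `a n` and `b` with weight `‖a n‖⁻¹` on `a n` converge to `w + b`. -/
lemma recc_of_tendsto {A : Set Plane} (hAc : IsClosed A) (hA : Convex ℝ A) {a : ℕ → Plane}
    (ha : ∀ n, a n ∈ A) (hn : Tendsto (fun n => ‖a n‖) atTop atTop) {w : Plane}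
    (hw : Tendsto (fun n => ‖a n‖⁻¹ • a n) atTop (𝓝 w)) : w ∈ recc A := by
  intro b hb
  have hi : Tendsto (fun n => ‖a n‖⁻¹) atTop (𝓝 0) := tendsto_inv_atTop_zero.comp hn
  have hl : Tendsto (fun n => ‖a n‖⁻¹ • a n + (1 - ‖a n‖⁻¹) • b) atTop (𝓝 (w + b)) := by
    have := hw.add ((tendsto_const_nhds (x := (1 : ℝ))).sub hi |>.smul_const b)
    simpa using this
  refine hAc.mem_of_tendsto hl ?_
  filter_upwards [hn.eventually_ge_atTop 1] with n h1
  exact hA (ha n) hb (by positivity) (by linarith [inv_le_one_of_one_le₀ h1]) (by ring)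

/-- An unbounded sequence in the superlevel set, normalized, would produce a unit vector `w` of the
sector with `⟨dir t, w⟩ ≥ 0`, against `inner_dir_neg_of_mem_sector`. -/
lemma isBounded_superlevel (hϑ : 0 < ϑ) (hϑ' : ϑ ≤ Real.pi / 2) {A : Set Plane}
    (hA : A ∈ CV (sector ϑ)) {t : ℝ} (ht : t ∈ Ioo (-ϑ) ϑ) (c : ℝ) :
    Bornology.IsBounded {a ∈ A | c ≤ inner ℝ (dir t) a} := by
  obtain ⟨-, hAc, hAx, hr⟩ := hA
  by_contra hcon
  rw [isBounded_iff_forall_norm_le] at hcon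
  push Not at hcon
  choose a ha hlt using fun n : ℕ => hcon n
  have hn : Tendsto (fun n => ‖a n‖) atTop atTop :=
    tendsto_atTop_mono (fun n => (hlt n).le) tendsto_natCast_atTop_atTop
  have hne : ∀ n, 0 < ‖a n‖ := fun n => (Nat.cast_nonneg n).trans_lt (hlt n)
  obtain ⟨w, hw, φ, hφ, hlim⟩ := (isCompact_sphere (0 : Plane) 1).tendsto_subseq
    (x := fun n => ‖a n‖⁻¹ • a n) fun n => by
      simp [norm_smul, (hne n).ne']
  have hφn : Tendsto (fun n => ‖a (φ n)‖) atTop atTop := hn.comp hφ.tendsto_atTop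
  have hwV : w ∈ sector ϑ := by
    rw [← hr]
    exact recc_of_tendsto hAc hAx (a := a ∘ φ) (fun n => (ha _).1) hφn hlim
  have hw0 : w ≠ 0 := by
    rintro rfl
    simp at hw
  refine (inner_dir_neg_of_mem_sector hϑ hϑ' hwV hw0 ht).not_ge ?_
  have hc : Tendsto (fun n => ‖a (φ n)‖⁻¹ * c) atTop (𝓝 0) := by
    simpa using (tendsto_inv_atTop_zero.comp hφn).mul_const c
  refine le_of_tendsto_of_tendsto hc ((tendsto_const_nhds (x := dir t)).inner hlim)
    (Eventually.of_forall fun n => ?_)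
  simp only [Function.comp_apply, inner_smul_right]
  exact mul_le_mul_of_nonneg_left (ha _).2 (by positivity)

lemma exists_inner_dir_le (hϑ : 0 < ϑ) (hϑ' : ϑ ≤ Real.pi / 2) {A : Set Plane}
    (hA : A ∈ CV (sector ϑ)) {t : ℝ} (ht : t ∈ Ioo (-ϑ) ϑ) :
    ∃ M : ℝ, ∀ a ∈ A, inner ℝ (dir t) a ≤ M := by
  obtain ⟨C, hC⟩ := isBounded_iff_forall_norm_le.1 (isBounded_superlevel hϑ hϑ' hA ht 0)
  refine ⟨max C 0, fun a ha => ?_⟩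
  rcases le_total 0 (inner ℝ (dir t) a) with h | h
  · have h1 := real_inner_le_norm (dir t) a
    rw [norm_dir, one_mul] at h1
    exact (h1.trans (hC a ⟨ha, h⟩)).trans (le_max_left _ _)
  · exact h.trans (le_max_right _ _)

lemma sectorBounded_of_mem_CV (hϑ : 0 < ϑ) (hϑ' : ϑ ≤ Real.pi / 2) {A : Set Plane}
    (hA : A ∈ CV (sector ϑ)) : SectorBounded (ϑ / 2) A := by
  -- Any angle strictly between `0` and `ϑ` would do; halving also keeps it below `π / 2`.
  obtain ⟨a, ha⟩ := exists_inner_dir_le hϑ hϑ' hA (t := ϑ / 2) ⟨by linarith, by linarith⟩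
  obtain ⟨b, hb⟩ := exists_inner_dir_le hϑ hϑ' hA (t := -(ϑ / 2)) ⟨by linarith, by linarith⟩
  exact sectorBounded_of_le ha hb

lemma isClosed_add_of_mem_CV (hϑ : 0 < ϑ) (hϑ' : ϑ ≤ Real.pi / 2) {A B : Set Plane}
    (hA : A ∈ CV (sector ϑ)) (hB : B ∈ CV (sector ϑ)) : IsClosed (A + B) :=
  (sectorBounded_of_mem_CV hϑ hϑ' hA).isClosed_add (by linarith) (by linarith)
    (sectorBounded_of_mem_CV hϑ hϑ' hB) hA.2.1 hB.2.1

lemma sectorBounded_sector (hϑ : 0 < ϑ) (hϑ' : ϑ ≤ Real.pi / 2) :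
    SectorBounded (ϑ / 2) (sector ϑ) :=
  sectorBounded_of_le (a := 0) (b := 0)
    (fun _ hx => (mem_sector_iff hϑ hϑ').1 hx _ ⟨by linarith, by linarith⟩)
    (fun _ hx => (mem_sector_iff hϑ hϑ').1 hx _ ⟨by linarith, by linarith⟩)

/-! ### Supporting half-planes -/

/-- A closed convex set receding along the sector is the intersection of its supporting half-planes
with normals `dir t`, `t ∈ (-ϑ, ϑ)`. -/
lemma mem_of_forall_inner_dir_le (hϑ : 0 < ϑ) (hϑ' : ϑ ≤ Real.pi / 2) {K : Set Plane}
    (hKc : IsClosed K) (hK : Convex ℝ K) (hne : K.Nonempty)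
    (hKV : ∀ v ∈ sector ϑ, ∀ k ∈ K, v + k ∈ K) {s : ℝ → ℝ}
    (hb : ∃ M : ℝ, ∀ k ∈ K, inner ℝ (dir 0) k ≤ M)
    (hs : ∀ t ∈ Ioo (-ϑ) ϑ, ∀ c, (∀ k ∈ K, inner ℝ (dir t) k ≤ c) → s t ≤ c) {x : Plane}
    (hx : ∀ t ∈ Ioo (-ϑ) ϑ, inner ℝ (dir t) x ≤ s t) : x ∈ K := by
  by_contra hxK
  obtain ⟨l, u, hlK, hlx⟩ := geometric_hahn_banach_closed_point hK hKc hxK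
  obtain ⟨M, hM⟩ := hb
  obtain ⟨k₀, hk₀⟩ := hne
  obtain ⟨n, rfl⟩ := (InnerProductSpace.toDual ℝ Plane).surjective l
  simp only [InnerProductSpace.toDual_apply_apply] at hlK hlx
  -- A positive value on `v` would make the functional unbounded on `k₀ + ℝ₊ v ⊆ K`.
  have hV : ∀ v ∈ sector ϑ, inner ℝ n v ≤ 0 := by
    intro v hv
    by_contra! hpos
    have h := hlK _ (hKV _ (smul_mem_sector hv (c := (|u - inner ℝ n k₀|) / inner ℝ n v)
      (by positivity)) _ hk₀)
    rw [inner_add_right, inner_smul_right, div_mul_cancel₀ _ hpos.ne'] at h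
    linarith [le_abs_self (u - inner ℝ n k₀)]
  -- The normal `n` may point in an extreme direction `dir (±ϑ)`. Adding a small multiple of `dir 0`
  -- turns it into the open range of angles, and the bound `M` keeps the separation strict.
  obtain ⟨ε, hε, hlt⟩ : ∃ ε : ℝ, 0 < ε ∧ u + ε * M < inner ℝ n x + ε * x 0 := by
    have hcont : Tendsto (fun ε : ℝ => inner ℝ n x + ε * x 0 - (u + ε * M)) (𝓝[>] 0)
        (𝓝 (inner ℝ n x - u)) := by
      have : Continuous fun ε : ℝ => inner ℝ n x + ε * x 0 - (u + ε * M) := by fun_prop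
      simpa using (this.tendsto 0).mono_left nhdsWithin_le_nhds
    obtain ⟨ε, h1, h2⟩ := ((hcont.eventually_const_lt (sub_pos.2 hlx)).and
      self_mem_nhdsWithin).exists
    exact ⟨ε, h2, by linarith⟩
  have hinner : ∀ v : Plane, inner ℝ n v = n 0 * v 0 + n 1 * v 1 := fun v => by
    simp [PiLp.inner_apply, Fin.sum_univ_two, mul_comm]
  have hsin := Real.sin_pos_of_pos_of_lt_pi hϑ (by linarith [Real.pi_pos])
  have hcos : 0 ≤ Real.cos ϑ := Real.cos_nonneg_of_mem_Icc ⟨by linarith, hϑ'⟩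
  have hn0 : 0 ≤ n 0 := by
    have := hV !₂[-1, 0] (by simp [sector, hcos])
    simp [hinner] at this
    exact this
  have hn1 : |n 1| * Real.cos ϑ ≤ n 0 * Real.sin ϑ := by
    have h1 := hV !₂[-Real.sin ϑ, Real.cos ϑ] (by
      simp [sector, abs_of_nonneg hcos, hsin.le, mul_comm])
    have h2 := hV !₂[-Real.sin ϑ, -Real.cos ϑ] (by
      simp [sector, abs_of_nonneg hcos, hsin.le, mul_comm])
    simp [hinner] at h1 h2
    rcases abs_cases (n 1) with h | h <;> rw [h.1] <;> linarith
  -- This is the polar angle of the perturbed normal, whose first coordinate is positive.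
  set t := Real.arctan (n 1 / (n 0 + ε)) with htdef
  have hN : 0 < n 0 + ε := by linarith
  have hct : 0 < Real.cos t := Real.cos_arctan_pos _
  have htan : Real.sin t * (n 0 + ε) = Real.cos t * n 1 := by
    have h1 : Real.tan t = n 1 / (n 0 + ε) := Real.tan_arctan _
    rw [Real.tan_eq_sin_div_cos, div_eq_div_iff hct.ne' hN.ne'] at h1
    linarith
  have ht : t ∈ Ioo (-ϑ) ϑ := by
    have hlt' : |n 1| * Real.cos ϑ < (n 0 + ε) * Real.sin ϑ := by nlinarith
    have h1 := Real.arctan_lt_pi_div_two (n 1 / (n 0 + ε))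
    have h2 := Real.neg_pi_div_two_lt_arctan (n 1 / (n 0 + ε))
    constructor
    · by_contra! hle
      have h3 : Real.sin (ϑ + t) ≤ 0 :=
        Real.sin_nonpos_of_nonpos_of_neg_pi_le (by linarith) (by linarith)
      rw [Real.sin_add] at h3
      have h4 := mul_nonpos_of_nonneg_of_nonpos hN.le h3
      have h5 : 0 < (n 0 + ε) * Real.sin ϑ + n 1 * Real.cos ϑ := by nlinarith [neg_abs_le (n 1)]
      linarith [mul_pos hct h5, congrArg (Real.cos ϑ * ·) htan]
    · by_contra! hle
      have h3 : 0 ≤ Real.sin (t - ϑ) :=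
        Real.sin_nonneg_of_nonneg_of_le_pi (by linarith) (by linarith)
      rw [Real.sin_sub] at h3
      have h4 := mul_nonneg hN.le h3
      have h5 : 0 < (n 0 + ε) * Real.sin ϑ - n 1 * Real.cos ϑ := by nlinarith [le_abs_self (n 1)]
      linarith [mul_pos hct h5, congrArg (Real.cos ϑ * ·) htan]
  have hdir : ∀ v : Plane, (n 0 + ε) * inner ℝ (dir t) v = Real.cos t * (inner ℝ n v + ε * v 0) := by
    intro v
    rw [inner_dir, hinner]
    linear_combination v 1 * htan
  have hle := hs t ht (Real.cos t * (u + ε * M) / (n 0 + ε)) fun k hk => by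
    rw [le_div_iff₀ hN, mul_comm, hdir]
    have := hM k hk
    rw [inner_dir_zero] at this
    have h2 := hlK k hk
    gcongr
  have h3 := (hx t ht).trans hle
  rw [le_div_iff₀ hN, mul_comm, hdir] at h3
  exact absurd (le_of_mul_le_mul_left h3 hct) (not_le.2 hlt)

end Sector

/-! ### Curves with prescribed tangential increments -/

/-- A function on an interval whose increments are bounded by the length of the step times the
increment of a real function is constant. -/
lemma eq_of_norm_sub_le {E : Type*} [NormedAddCommGroup E] {I : Set ℝ} (hI : I.OrdConnected)
    {F : ℝ → E} {m : ℝ → ℝ}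
    (hF : ∀ s ∈ I, ∀ t ∈ I, s ≤ t → ‖F t - F s‖ ≤ (t - s) * (m t - m s)) {s t : ℝ}
    (hs : s ∈ I) (ht : t ∈ I) : F s = F t := by
  wlog hst : s ≤ t generalizing s t
  · exact (this ht hs (le_of_not_ge hst)).symm
  -- Subdivide into `n + 1` equal steps: the step length factors out and the increments of `m`
  -- telescope.
  have key : ∀ n : ℕ, ‖F t - F s‖ ≤ (t - s) * (m t - m s) / ((n : ℝ) + 1) := by
    intro n
    have hn : (0 : ℝ) < (n : ℝ) + 1 := by positivity
    set x : ℕ → ℝ := fun i => s + i * ((t - s) / ((n : ℝ) + 1)) with hx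
    have hstep : 0 ≤ (t - s) / ((n : ℝ) + 1) := div_nonneg (by linarith) hn.le
    have hmem : ∀ i ≤ n + 1, x i ∈ I := by
      intro i hi
      refine hI.out hs ht ⟨by simp only [hx]; nlinarith [Nat.cast_nonneg (α := ℝ) i], ?_⟩
      have h1 : (i : ℝ) ≤ (n : ℝ) + 1 := by exact_mod_cast hi
      have h2 := mul_le_mul_of_nonneg_right h1 hstep
      rw [mul_div_cancel₀ _ hn.ne'] at h2
      simp only [hx]
      linarith
    have hx0 : x 0 = s := by simp [hx]
    have hxn : x (n + 1) = t := by simp [hx]; field_simp; ring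
    have hd : ∀ i, x (i + 1) - x i = (t - s) / ((n : ℝ) + 1) := fun i => by
      simp only [hx]; push_cast; ring
    calc ‖F t - F s‖ = ‖∑ i ∈ Finset.range (n + 1), (F (x (i + 1)) - F (x i))‖ := by
          rw [Finset.sum_range_sub (fun i => F (x i)), hx0, hxn]
      _ ≤ ∑ i ∈ Finset.range (n + 1), ((t - s) / ((n : ℝ) + 1)) * (m (x (i + 1)) - m (x i)) := by
          refine norm_sum_le_of_le _ fun i hi => ?_
          rw [Finset.mem_range] at hi
          rw [← hd i]
          exact hF _ (hmem i (by omega)) _ (hmem (i + 1) (by omega)) (by linarith [hd i])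
      _ = (t - s) * (m t - m s) / ((n : ℝ) + 1) := by
          rw [← Finset.mul_sum, Finset.sum_range_sub (fun i => m (x i)), hx0, hxn]; ring
  have hlim : Tendsto (fun n : ℕ => (t - s) * (m t - m s) / ((n : ℝ) + 1)) atTop (𝓝 0) := by
    have := (tendsto_one_div_add_atTop_nhds_zero_nat (𝕜 := ℝ)).const_mul ((t - s) * (m t - m s))
    simpa [div_eq_mul_inv] using this
  have := ge_of_tendsto' hlim key
  exact (sub_eq_zero.1 (norm_le_zero_iff.1 this)).symm

/-- Informally `dH = tang df` on `(-ϑ, ϑ)`, with an error controlled by the function `m`. -/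
def TangentialOn (ϑ : ℝ) (H : ℝ → Plane) (f m : ℝ → ℝ) : Prop :=
  ∀ s ∈ Ioo (-ϑ) ϑ, ∀ t ∈ Ioo (-ϑ) ϑ, s ≤ t →
    ‖H t - H s - (f t - f s) • tang s‖ ≤ (t - s) * (m t - m s)

section
variable {ϑ : ℝ} {H G : ℝ → Plane} {f g m k : ℝ → ℝ}

lemma TangentialOn.add (h₁ : TangentialOn ϑ H f m) (h₂ : TangentialOn ϑ G g k) :
    TangentialOn ϑ (fun t => H t + G t) (fun t => f t + g t) (fun t => m t + k t) := by
  intro s hs t ht hst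
  calc _ = ‖(H t - H s - (f t - f s) • tang s) + (G t - G s - (g t - g s) • tang s)‖ := by
        congr 1; module
    _ ≤ _ := (norm_add_le _ _).trans (by linarith [h₁ s hs t ht hst, h₂ s hs t ht hst])

lemma TangentialOn.sub (h₁ : TangentialOn ϑ H f m) (h₂ : TangentialOn ϑ G g k) :
    TangentialOn ϑ (fun t => H t - G t) (fun t => f t - g t) (fun t => m t + k t) := by
  intro s hs t ht hst
  calc _ = ‖(H t - H s - (f t - f s) • tang s) - (G t - G s - (g t - g s) • tang s)‖ := by
        congr 1; module
    _ ≤ _ := (norm_sub_le _ _).trans (by linarith [h₁ s hs t ht hst, h₂ s hs t ht hst])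

/-- The increments of the curve are determined by those of the function. -/
lemma TangentialOn.sub_eq_sub (h₁ : TangentialOn ϑ H f m) (h₂ : TangentialOn ϑ G g k)
    (hfg : ∀ s ∈ Ioo (-ϑ) ϑ, ∀ t ∈ Ioo (-ϑ) ϑ, f t - f s = g t - g s) {s t : ℝ}
    (hs : s ∈ Ioo (-ϑ) ϑ) (ht : t ∈ Ioo (-ϑ) ϑ) : H t - H s = G t - G s := by
  have := eq_of_norm_sub_le ordConnected_Ioo (F := fun t => H t - G t)
    (m := fun t => m t + k t) (fun s hs t ht hst => by
      have h := (h₁.sub h₂) s hs t ht hst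
      have h0 : f t - g t - (f s - g s) = 0 := by linarith [hfg s hs t ht]
      rwa [h0, zero_smul, sub_zero] at h) hs ht
  rw [sub_eq_sub_iff_sub_eq_sub, ← this]

/-- The increments of the function are determined by those of the curve. -/
lemma TangentialOn.fun_sub_eq_sub (h₁ : TangentialOn ϑ H f m) (h₂ : TangentialOn ϑ G g k)
    (hHG : ∀ s ∈ Ioo (-ϑ) ϑ, ∀ t ∈ Ioo (-ϑ) ϑ, H t - H s = G t - G s) {s t : ℝ}
    (hs : s ∈ Ioo (-ϑ) ϑ) (ht : t ∈ Ioo (-ϑ) ϑ) : f t - f s = g t - g s := by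
  have := eq_of_norm_sub_le ordConnected_Ioo (F := fun t => f t - g t)
    (m := fun t => m t + k t) (fun s hs t ht hst => by
      have h := (h₁.sub h₂) s hs t ht hst
      have h0 : H t - G t - (H s - G s) = 0 := by
        rw [sub_eq_zero, sub_eq_sub_iff_sub_eq_sub]; exact hHG s hs t ht
      rw [h0, zero_sub, norm_neg, norm_smul, norm_tang, mul_one] at h
      exact h) hs ht
  linarith

/-- On each step the error splits into moving the tag to the left end (`tang` is 1-Lipschitz) and
the tangential defect of `H`. They are at most the mesh times the increment of `f`, with factors `1`
and `C`, and the sum telescopes. -/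
lemma TangentialOn.hasStieltjesIntegral {C : ℝ} (hH : TangentialOn ϑ H f fun t => C * f t)
    (hC : 0 ≤ C) (hf : MonotoneOn f (Ioo (-ϑ) ϑ)) {a b : ℝ} (ha : a ∈ Ioo (-ϑ) ϑ)
    (hb : b ∈ Ioo (-ϑ) ϑ) (hab : a ≤ b) : HasStieltjesIntegral tang f a b (H b - H a) := by
  intro ε hε
  have hfab : 0 ≤ f b - f a := sub_nonneg.2 (hf ha hb hab)
  set D := (C + 1) * (f b - f a) with hD
  have hD0 : 0 ≤ D := by positivity
  -- `D` vanishes when `f a = f b`, hence `D + 1`.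
  refine ⟨ε / (D + 1), by positivity, ?_⟩
  intro n x ξ hx0 hxn hx
  have hstep : ∀ i < n, x i ≤ x (i + 1) := fun i hi => (hx i hi).1.trans (hx i hi).2.1
  have hle : ∀ i ≤ n, a ≤ x i := by
    intro i hi
    induction i with
    | zero => exact hx0.ge
    | succ i ih => exact (ih (by omega)).trans (hstep i (by omega))
  have hge : ∀ j ≤ n, x (n - j) ≤ b := by
    intro j hj
    induction j with
    | zero => exact hxn.le
    | succ j ih =>
      have h := hstep (n - (j + 1)) (by omega)
      rw [show n - (j + 1) + 1 = n - j by omega] at h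
      exact h.trans (ih (by omega))
  have hmem : ∀ i ≤ n, x i ∈ Ioo (-ϑ) ϑ := fun i hi =>
    ⟨ha.1.trans_le (hle i hi), lt_of_le_of_lt (by
      have := hge (n - i) (by omega)
      rwa [show n - (n - i) = i by omega] at this) hb.2⟩
  calc _ = ‖∑ i ∈ Finset.range n, ((f (x (i + 1)) - f (x i)) • (tang (ξ i) - tang (x i)) -
          (H (x (i + 1)) - H (x i) - (f (x (i + 1)) - f (x i)) • tang (x i)))‖ := by
        rw [show H b - H a = ∑ i ∈ Finset.range n, (H (x (i + 1)) - H (x i)) by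
          rw [Finset.sum_range_sub (fun i => H (x i)), hx0, hxn], ← Finset.sum_sub_distrib]
        congr 1
        refine Finset.sum_congr rfl fun i _ => ?_
        module
    _ ≤ ∑ i ∈ Finset.range n, (ε / (D + 1)) * ((C + 1) * (f (x (i + 1)) - f (x i))) := by
        refine norm_sum_le_of_le _ fun i hi => (norm_sub_le _ _).trans ?_
        rw [Finset.mem_range] at hi
        obtain ⟨h1, h2, h3⟩ := hx i hi
        have hf0 : 0 ≤ f (x (i + 1)) - f (x i) :=
          sub_nonneg.2 (hf (hmem i hi.le) (hmem (i + 1) hi) (hstep i hi))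
        have h4 := hH _ (hmem i hi.le) _ (hmem (i + 1) hi) (hstep i hi)
        have h5 : ‖tang (ξ i) - tang (x i)‖ ≤ ε / (D + 1) :=
          (norm_tang_sub_le _ _).trans (by rw [abs_of_nonneg (by linarith)]; linarith)
        rw [norm_smul, Real.norm_of_nonneg hf0]
        have h6 := mul_le_mul_of_nonneg_left h5 hf0
        have h7 := mul_le_mul_of_nonneg_right h3.le (mul_nonneg hC hf0)
        linarith
    _ = ε / (D + 1) * D := by
        rw [← Finset.mul_sum, ← Finset.mul_sum, Finset.sum_range_sub (fun i => f (x i)), hx0, hxn]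
    _ < ε := by
        rw [div_mul_eq_mul_div, div_lt_iff₀ (by positivity)]
        nlinarith

/-- Both values are compared with one sum over a fine uniform partition. For `a > b` there are no
partitions and every value would qualify. -/
lemma HasStieltjesIntegral.unique {φ : ℝ → Plane} {a b : ℝ} (hab : a ≤ b) {I J : Plane}
    (hI : HasStieltjesIntegral φ f a b I) (hJ : HasStieltjesIntegral φ f a b J) : I = J := by
  by_contra hne
  have hpos : 0 < ‖I - J‖ / 2 := by have := norm_pos_iff.2 (sub_ne_zero.2 hne); positivity
  obtain ⟨δ, hδ, h⟩ := hI _ hpos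
  obtain ⟨δ', hδ', h'⟩ := hJ _ hpos
  obtain ⟨n, hn⟩ := exists_nat_gt ((b - a) / min δ δ')
  have hδδ : 0 < min δ δ' := lt_min hδ hδ'
  have hn0 : (0 : ℝ) < n := (div_nonneg (by linarith) hδδ.le).trans_lt hn
  have hlt : (b - a) / n < min δ δ' := by
    rw [div_lt_iff₀ hn0]
    rw [div_lt_iff₀ hδδ] at hn
    linarith
  have hst : 0 ≤ (b - a) / n := div_nonneg (by linarith) hn0.le
  have hd : ∀ i : ℕ, a + ((i + 1 : ℕ) : ℝ) * ((b - a) / n) = a + i * ((b - a) / n) + (b - a) / n :=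
    fun i => by push_cast; ring
  have e1 := h n (fun i => a + i * ((b - a) / n)) (fun i => a + i * ((b - a) / n)) (by simp)
    (by field_simp; ring) fun i _ => ⟨le_rfl, by rw [hd]; linarith, by
      rw [hd]; linarith [min_le_left δ δ']⟩
  have e2 := h' n (fun i => a + i * ((b - a) / n)) (fun i => a + i * ((b - a) / n)) (by simp)
    (by field_simp; ring) fun i _ => ⟨le_rfl, by rw [hd]; linarith, by
      rw [hd]; linarith [min_le_right δ δ']⟩
  have := norm_sub_le_norm_sub_add_norm_sub I
    (∑ i ∈ Finset.range n, (f (a + ((i + 1 : ℕ) : ℝ) * ((b - a) / n)) - f (a + i * ((b - a) / n))) •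
      φ (a + i * ((b - a) / n))) J
  rw [norm_sub_rev I (Finset.sum _ _)] at this
  linarith

lemma stieltjesIntegral_eq {φ : ℝ → Plane} {a b : ℝ} (hab : a ≤ b) {I : Plane}
    (hI : HasStieltjesIntegral φ f a b I) : stieltjesIntegral φ f a b = I := by
  have hex : ∃ I, HasStieltjesIntegral φ f a b I := ⟨I, hI⟩
  rw [stieltjesIntegral, dif_pos hex]
  exact hex.choose_spec.unique hab hI

/-- Integration by parts of `∫ tang df`. -/
noncomputable def partsFun (f : ℝ → ℝ) (t : ℝ) : Plane :=
  f t • tang t + ∫ r in (0 : ℝ)..t, f r • dir r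

lemma hasDerivAt_tang (t : ℝ) : HasDerivAt tang (-dir t) t := by
  rw [hasDerivAt_iff_hasFDerivAt, ← hasFDerivWithinAt_univ, hasFDerivWithinAt_euclidean]
  intro i
  rw [hasFDerivWithinAt_univ]
  refine HasDerivAt.hasFDerivAt (f' := (-dir t) i) ?_ |>.congr_fderiv ?_
  rotate_left
  · ext; simp
  fin_cases i
  · simpa [tang, dir] using (Real.hasDerivAt_sin t).fun_neg
  · simpa [tang, dir] using Real.hasDerivAt_cos t

lemma integral_dir (s t : ℝ) : ∫ r in s..t, dir r = tang s - tang t := by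
  have := intervalIntegral.integral_eq_sub_of_hasDerivAt (f := fun r => -tang r) (f' := dir)
    (a := s) (b := t) (fun r _ => by simpa using (hasDerivAt_tang r).fun_neg)
    (continuous_dir.intervalIntegrable _ _)
  rw [this]; abel

lemma intervalIntegrable_smul_dir (hf : MonotoneOn f (Ioo (-ϑ) ϑ)) {a b : ℝ}
    (ha : a ∈ Ioo (-ϑ) ϑ) (hb : b ∈ Ioo (-ϑ) ϑ) :
    IntervalIntegrable (fun r => f r • dir r) MeasureTheory.volume a b :=
  IntervalIntegrable.smul_continuousOn
    (MonotoneOn.intervalIntegrable (hf.mono (ordConnected_Ioo.uIcc_subset ha hb)))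
    continuous_dir.continuousOn

/-- Since `∫_s^t dir = tang s - tang t`, the defect equals `∫_s^t (f r - f t) • dir r`, with
integrand of norm at most `f t - f s`. This provides the existence of the Stieltjes integrals. -/
lemma tangentialOn_partsFun (hϑ : 0 < ϑ) (hf : MonotoneOn f (Ioo (-ϑ) ϑ)) :
    TangentialOn ϑ (partsFun f) f f := by
  intro s hs t ht hst
  have h0 := zero_mem_Ioo hϑ
  have hsplit : ∫ r in (0 : ℝ)..t, f r • dir r =
      (∫ r in (0 : ℝ)..s, f r • dir r) + ∫ r in s..t, f r • dir r :=
    (intervalIntegral.integral_add_adjacent_intervals (intervalIntegrable_smul_dir hf h0 hs)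
      (intervalIntegrable_smul_dir hf hs ht)).symm
  have hI : ∫ r in s..t, (f r • dir r - f t • dir r) =
      (∫ r in s..t, f r • dir r) - f t • (tang s - tang t) := by
    rw [intervalIntegral.integral_sub (intervalIntegrable_smul_dir hf hs ht)
      (g := fun r => f t • dir r) ((continuous_dir.const_smul (f t)).intervalIntegrable s t), intervalIntegral.integral_smul,
      integral_dir]
  have heq : partsFun f t - partsFun f s - (f t - f s) • tang s =
      ∫ r in s..t, (f r • dir r - f t • dir r) := by
    rw [hI, partsFun, partsFun, hsplit]
    module
  rw [heq, mul_comm]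
  refine (intervalIntegral.norm_integral_le_of_norm_le_const fun r hr => ?_).trans
    (by rw [abs_of_nonneg (by linarith : 0 ≤ t - s)])
  rw [uIoc_of_le hst] at hr
  have hrI : r ∈ Ioo (-ϑ) ϑ := ⟨hs.1.trans hr.1, hr.2.trans_lt ht.2⟩
  rw [← sub_smul, norm_smul, norm_dir, mul_one, Real.norm_eq_abs, abs_sub_comm,
    abs_of_nonneg (sub_nonneg.2 (hf hrI ht hr.2))]
  linarith [hf hs hrI hr.1.le]

/-- `genFun f` is given by any curve whose tangential increments are those of `f`. -/
lemma TangentialOn.genFun_eq (hϑ : 0 < ϑ) {C : ℝ} (hH : TangentialOn ϑ H f fun t => C * f t)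
    (hC : 0 ≤ C) (hf : MonotoneOn f (Ioo (-ϑ) ϑ)) {t : ℝ} (ht : t ∈ Ioo (-ϑ) ϑ) :
    genFun f t = H t - H 0 := by
  have h0 := zero_mem_Ioo hϑ
  rw [genFun]
  split_ifs with h
  · exact stieltjesIntegral_eq h (hH.hasStieltjesIntegral hC hf h0 ht h)
  · rw [stieltjesIntegral_eq (not_le.1 h).le
      (hH.hasStieltjesIntegral hC hf ht h0 (not_le.1 h).le), neg_sub]

lemma tangentialOn_genFun (hϑ : 0 < ϑ) (hf : IsNondecr ϑ f) : TangentialOn ϑ (genFun f) f f := by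
  have h := tangentialOn_partsFun hϑ hf.1
  intro s hs t ht hst
  have h1 : TangentialOn ϑ (partsFun f) f fun t => 1 * f t := by simpa using h
  rw [h1.genFun_eq hϑ zero_le_one hf.1 hs, h1.genFun_eq hϑ zero_le_one hf.1 ht,
    sub_sub_sub_cancel_right]
  exact h s hs t ht hst

lemma genFun_zero (hϑ : 0 < ϑ) (hf : IsNondecr ϑ f) : genFun f 0 = 0 := by
  have h1 : TangentialOn ϑ (partsFun f) f fun t => 1 * f t := by
    simpa using tangentialOn_partsFun hϑ hf.1
  rw [h1.genFun_eq hϑ zero_le_one hf.1 (zero_mem_Ioo hϑ), sub_self]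

/-- The inner products with `e` of the increments of a curve between `a` and `b` are nonnegative if
those of its tangent directions are. -/
lemma TangentialOn.inner_sub_nonneg (hH : TangentialOn ϑ H f f) (hf : MonotoneOn f (Ioo (-ϑ) ϑ))
    {a b : ℝ} (ha : a ∈ Ioo (-ϑ) ϑ) (hb : b ∈ Ioo (-ϑ) ϑ) (hab : a ≤ b) {e : Plane}
    (he : ∀ r ∈ Icc a b, 0 ≤ inner ℝ e (tang r)) : 0 ≤ inner ℝ e (H b - H a) := by
  have hst := TangentialOn.hasStieltjesIntegral (C := 1) (by simpa using hH) zero_le_one hf ha hb hab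
  by_contra! hneg
  -- A sum this close to `H b - H a` would also have a negative product with `e`, but each term of a
  -- left-tagged sum contributes a nonnegative amount. The `+ 1` covers `e = 0`.
  obtain ⟨δ, hδ, h⟩ := hst (-(inner ℝ e (H b - H a)) / (‖e‖ + 1)) (div_pos (by linarith) (by positivity))
  obtain ⟨n, hn⟩ := exists_nat_gt ((b - a) / δ)
  have hn0 : (0 : ℝ) < n := (div_nonneg (by linarith) hδ.le).trans_lt hn
  have hlt : (b - a) / n < δ := by
    rw [div_lt_iff₀ hn0]
    rw [div_lt_iff₀ hδ] at hn
    linarith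
  have hst : 0 ≤ (b - a) / n := div_nonneg (by linarith) hn0.le
  have hd : ∀ i : ℕ, a + ((i + 1 : ℕ) : ℝ) * ((b - a) / n) = a + i * ((b - a) / n) + (b - a) / n :=
    fun i => by push_cast; ring
  have hmem : ∀ i ≤ n, a + (i : ℝ) * ((b - a) / n) ∈ Icc a b := by
    intro i hi
    have h1 : (i : ℝ) ≤ n := by exact_mod_cast hi
    have h2 := mul_le_mul_of_nonneg_right h1 hst
    rw [mul_div_cancel₀ _ hn0.ne'] at h2
    exact ⟨by have := mul_nonneg (Nat.cast_nonneg (α := ℝ) i) hst; linarith, by linarith⟩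
  have hI : ∀ x ∈ Icc a b, x ∈ Ioo (-ϑ) ϑ := fun x hx => ordConnected_Ioo.out ha hb hx
  have e1 := h n (fun i => a + i * ((b - a) / n)) (fun i => a + i * ((b - a) / n)) (by simp)
    (by field_simp; ring) fun i _ => ⟨le_rfl, by rw [hd]; linarith, by rw [hd]; linarith⟩
  set S := ∑ i ∈ Finset.range n, (f (a + ((i + 1 : ℕ) : ℝ) * ((b - a) / n)) -
    f (a + i * ((b - a) / n))) • tang (a + i * ((b - a) / n)) with hS
  have hSn : 0 ≤ inner ℝ e S := by
    rw [hS, inner_sum]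
    refine Finset.sum_nonneg fun i hi => ?_
    rw [Finset.mem_range] at hi
    rw [inner_smul_right]
    refine mul_nonneg (sub_nonneg.2 (hf (hI _ (hmem i hi.le)) (hI _ (hmem (i + 1) hi)) ?_))
      (he _ (hmem i hi.le))
    rw [hd]; linarith
  have h3 : -(inner ℝ e (H b - H a)) ≤ ‖e‖ * ‖S - (H b - H a)‖ := by
    refine le_trans ?_ (real_inner_le_norm e _)
    rw [inner_sub_right e S]; linarith
  rw [lt_div_iff₀ (by positivity)] at e1
  nlinarith [norm_nonneg e, norm_nonneg (S - (H b - H a))]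

/-- The point `H t` of a tangential curve supports the curve in the direction `dir t`. -/
lemma TangentialOn.inner_dir_le (hϑ' : ϑ ≤ Real.pi / 2) (hH : TangentialOn ϑ H f f)
    (hf : MonotoneOn f (Ioo (-ϑ) ϑ)) {s t : ℝ} (hs : s ∈ Ioo (-ϑ) ϑ) (ht : t ∈ Ioo (-ϑ) ϑ) :
    inner ℝ (dir t) (H s) ≤ inner ℝ (dir t) (H t) := by
  rcases le_total s t with hst | hst
  · have := hH.inner_sub_nonneg hf hs ht hst (e := dir t) fun r hr => by
      rw [inner_dir_tang]
      exact Real.sin_nonneg_of_nonneg_of_le_pi (by linarith [hr.2])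
        (by linarith [hr.1, hs.1, ht.2])
    rw [inner_sub_right] at this
    linarith
  · have := hH.inner_sub_nonneg hf ht hs hst (e := -dir t) fun r hr => by
      rw [inner_neg_left, inner_dir_tang, ← Real.sin_neg]
      exact Real.sin_nonneg_of_nonneg_of_le_pi (by linarith [hr.1])
        (by linarith [hr.2, hs.2, ht.1])
    rw [inner_neg_left, inner_sub_right] at this
    linarith

/-! ### The generated sets -/

/-- The half-plane is closed and convex, contains the whole curve, and absorbs the sector. Hence the
support function of `A_f` at `dir t` is attained at `H_f(t)`. -/
lemma inner_dir_le_of_mem_genSet (hϑ : 0 < ϑ) (hϑ' : ϑ ≤ Real.pi / 2) (hf : IsNondecr ϑ f)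
    {x : Plane} (hx : x ∈ genSet ϑ f) {t : ℝ} (ht : t ∈ Ioo (-ϑ) ϑ) :
    inner ℝ (dir t) x ≤ inner ℝ (dir t) (genFun f t) := by
  obtain ⟨y, hy, v, hv, rfl⟩ := hx
  have hcl : IsClosed {y : Plane | inner ℝ (dir t) y ≤ inner ℝ (dir t) (genFun f t)} :=
    isClosed_le (continuous_const.inner continuous_id) continuous_const
  have hcx : Convex ℝ {y : Plane | inner ℝ (dir t) y ≤ inner ℝ (dir t) (genFun f t)} :=
    convex_halfSpace_le (innerSL ℝ (dir t)).toLinearMap.isLinear _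
  have hy' : inner ℝ (dir t) y ≤ inner ℝ (dir t) (genFun f t) := by
    refine closure_minimal (convexHull_min ?_ hcx) hcl hy
    rintro _ ⟨s, hs, rfl⟩
    exact (tangentialOn_genFun hϑ hf).inner_dir_le hϑ' hf.1 hs ht
  have := (mem_sector_iff hϑ hϑ').1 hv t ht
  simp only [inner_add_right]
  linarith

lemma genFun_mem_genSet {t : ℝ} (ht : t ∈ Ioo (-ϑ) ϑ) : genFun f t ∈ genSet ϑ f :=
  ⟨genFun f t, subset_closure (subset_convexHull _ _ ⟨t, ht, rfl⟩), 0, zero_mem_sector, add_zero _⟩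

lemma zero_mem_genSet (hϑ : 0 < ϑ) (hf : IsNondecr ϑ f) : (0 : Plane) ∈ genSet ϑ f := by
  have := genFun_mem_genSet (f := f) (zero_mem_Ioo hϑ)
  rwa [genFun_zero hϑ hf] at this

/-- A vector along which a set bounded in the directions `dir t` recedes lies in the sector. -/
lemma mem_sector_of_add_mem (hϑ : 0 < ϑ) (hϑ' : ϑ ≤ Real.pi / 2) {A : Set Plane}
    (hne : A.Nonempty) {s : ℝ → ℝ} (hs : ∀ t ∈ Ioo (-ϑ) ϑ, ∀ a ∈ A, inner ℝ (dir t) a ≤ s t)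
    {w : Plane} (hw : w ∈ recc A) : w ∈ sector ϑ := by
  obtain ⟨a, ha⟩ := hne
  have hn : ∀ n : ℕ, (n : ℝ) • w + a ∈ A := by
    intro n
    induction n with
    | zero => simpa using ha
    | succ n ih =>
      have := hw _ ih
      rwa [show w + ((n : ℝ) • w + a) = ((n + 1 : ℕ) : ℝ) • w + a by push_cast; module] at this
  rw [mem_sector_iff hϑ hϑ']
  intro t ht
  by_contra! hpos
  obtain ⟨n, hlt⟩ := exists_nat_gt ((s t - inner ℝ (dir t) a) / inner ℝ (dir t) w)
  rw [div_lt_iff₀ hpos] at hlt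
  have := hs t ht _ (hn n)
  rw [inner_add_right, inner_smul_right] at this
  linarith

lemma genSet_mem_CV (hϑ : 0 < ϑ) (hϑ' : ϑ ≤ Real.pi / 2) (hf : IsNondecr ϑ f) :
    genSet ϑ f ∈ CV (sector ϑ) := by
  have hne : (genSet ϑ f).Nonempty := ⟨0, zero_mem_genSet hϑ hf⟩
  refine ⟨hne, ?_, (convex_convexHull ℝ _).closure.add (convex_sector hϑ hϑ'), ?_⟩
  · have hsub : closure (convexHull ℝ (genFun f '' Ioo (-ϑ) ϑ)) ⊆ genSet ϑ f :=
      fun y hy => ⟨y, hy, 0, zero_mem_sector, add_zero _⟩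
    refine SectorBounded.isClosed_add (τ := ϑ / 2) (by linarith) (by linarith)
      (sectorBounded_of_le
        (fun x hx => inner_dir_le_of_mem_genSet hϑ hϑ' hf (hsub hx) ⟨by linarith, by linarith⟩)
        (fun x hx => inner_dir_le_of_mem_genSet hϑ hϑ' hf (hsub hx) ⟨by linarith, by linarith⟩))
      (sectorBounded_sector hϑ hϑ') isClosed_closure isClosed_sector
  · refine Subset.antisymm (fun w hw => mem_sector_of_add_mem hϑ hϑ' hne
      (fun t ht a ha => inner_dir_le_of_mem_genSet hϑ hϑ' hf ha ht) hw) ?_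
    rintro w hw _ ⟨y, hy, v, hv, rfl⟩
    exact ⟨y, hy, w + v, add_mem_sector hϑ hϑ' hw hv, by simp only []; abel⟩

lemma add_singleton_mem_CV {V A : Set Plane} (hA : A ∈ CV V) (z : Plane) : A + {z} ∈ CV V := by
  obtain ⟨hne, hc, hx, hr⟩ := hA
  refine ⟨hne.add (singleton_nonempty z), ?_, hx.add (convex_singleton z), ?_⟩
  · rw [add_singleton]
    exact (Homeomorph.addRight z).isClosedMap _ hc
  · rw [← hr]
    ext w
    simp only [recc, add_singleton, mem_ofPred_eq, forall_mem_image]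
    refine forall₂_congr fun a _ => ?_
    rw [← add_assoc]
    exact (add_left_injective z).mem_set_image

end

/-! ### Support sets and the boundary function -/

lemma image_coord_segment (a b : Plane) (i : Fin 2) :
    (fun x : Plane => x i) '' segment ℝ a b = uIcc (a i) (b i) := by
  rw [← segment_eq_uIcc]
  exact image_segment ℝ (EuclideanSpace.proj i : Plane →L[ℝ] ℝ).toLinearMap.toAffineMap a b

/-- Each coordinate projection of a segment is an interval that determines the sum of its end
points, whatever their order. This makes `segCenter` independent of the choice made in its
definition. -/
lemma midpoint_eq_of_segment_eq {a b c d : Plane} (h : segment ℝ a b = segment ℝ c d) :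
    midpoint ℝ a b = midpoint ℝ c d := by
  have key : ∀ i, a i + b i = c i + d i := fun i => by
    have h1 := congrArg (image fun x : Plane => x i) h
    rw [image_coord_segment, image_coord_segment, uIcc, uIcc] at h1
    have h2 := (Icc_eq_Icc_iff inf_le_sup).1 h1
    rw [← inf_add_sup (a i) (b i), ← inf_add_sup (c i) (d i), h2.1, h2.2]
  rw [midpoint_eq_smul_add, midpoint_eq_smul_add]
  congr 1
  ext i
  exact key i

lemma segCenter_segment (a b : Plane) : segCenter (segment ℝ a b) = midpoint ℝ a b := by
  have h : ∃ c, ∃ a' b' : Plane, segment ℝ a b = segment ℝ a' b' ∧ c = midpoint ℝ a' b' :=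
    ⟨_, a, b, rfl, rfl⟩
  rw [segCenter, dif_pos h]
  obtain ⟨a', b', h1, h2⟩ := h.choose_spec
  rw [h2, midpoint_eq_of_segment_eq h1]

section
variable {ϑ : ℝ} {A : Set Plane}

lemma supportSet_nonempty (hϑ : 0 < ϑ) (hϑ' : ϑ ≤ Real.pi / 2) (hA : A ∈ CV (sector ϑ)) {t : ℝ}
    (ht : t ∈ Ioo (-ϑ) ϑ) : (supportSet A (dir t)).Nonempty := by
  obtain ⟨a₀, ha₀⟩ := hA.1
  have hcont : Continuous fun a : Plane => inner ℝ (dir t) a := by fun_prop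
  have hK : IsCompact {a ∈ A | inner ℝ (dir t) a₀ ≤ inner ℝ (dir t) a} :=
    Metric.isCompact_of_isClosed_isBounded
      (hA.2.1.inter (isClosed_le continuous_const hcont)) (isBounded_superlevel hϑ hϑ' hA ht _)
  obtain ⟨p, hp, hmax⟩ := hK.exists_isMaxOn ⟨a₀, ha₀, le_rfl⟩ hcont.continuousOn
  refine ⟨p, hp.1, fun b hb => ?_⟩
  rcases le_total (inner ℝ (dir t) a₀) (inner ℝ (dir t) b) with h | h
  · exact hmax ⟨hb, h⟩
  · exact h.trans hp.2

lemma isCompact_supportSet (hϑ : 0 < ϑ) (hϑ' : ϑ ≤ Real.pi / 2) (hA : A ∈ CV (sector ϑ)) {t : ℝ}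
    (ht : t ∈ Ioo (-ϑ) ϑ) : IsCompact (supportSet A (dir t)) := by
  obtain ⟨a₀, ha₀⟩ := hA.1
  refine Metric.isCompact_of_isClosed_isBounded ?_
    ((isBounded_superlevel hϑ hϑ' hA ht (inner ℝ (dir t) a₀)).subset fun a ha => ⟨ha.1, ha.2 _ ha₀⟩)
  have : supportSet A (dir t) = A ∩ ⋂ b ∈ A, {a | inner ℝ (dir t) b ≤ inner ℝ (dir t) a} := by
    ext a; simp [supportSet]
  rw [this]
  exact hA.2.1.inter (isClosed_biInter fun b _ =>
    isClosed_le continuous_const (continuous_const.inner continuous_id))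

lemma convex_supportSet (hA : Convex ℝ A) (u : Plane) : Convex ℝ (supportSet A u) := by
  intro a ha b hb c d hc hd hcd
  refine ⟨hA ha.1 hb.1 hc hd hcd, fun x hx => ?_⟩
  rw [inner_add_right, inner_smul_right, inner_smul_right]
  have h1 := mul_le_mul_of_nonneg_left (ha.2 x hx) hc
  have h2 := mul_le_mul_of_nonneg_left (hb.2 x hx) hd
  calc inner ℝ u x = c * inner ℝ u x + d * inner ℝ u x := by rw [← add_mul, hcd, one_mul]
    _ ≤ _ := add_le_add h1 h2

/-- The support set in the direction `dir t` is a segment; its end points are extremal in the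
direction `tang t`. -/
lemma exists_supportSet_eq_segment (hϑ : 0 < ϑ) (hϑ' : ϑ ≤ Real.pi / 2) (hA : A ∈ CV (sector ϑ))
    {t : ℝ} (ht : t ∈ Ioo (-ϑ) ϑ) :
    ∃ q ∈ supportSet A (dir t), ∃ p ∈ supportSet A (dir t),
      supportSet A (dir t) = segment ℝ q p ∧ ∀ x ∈ supportSet A (dir t),
        inner ℝ (tang t) q ≤ inner ℝ (tang t) x ∧ inner ℝ (tang t) x ≤ inner ℝ (tang t) p := by
  have hK := isCompact_supportSet hϑ hϑ' hA ht
  have hne := supportSet_nonempty hϑ hϑ' hA ht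
  have hcont : Continuous fun a : Plane => inner ℝ (tang t) a := by fun_prop
  obtain ⟨p, hp, hpm⟩ := hK.exists_isMaxOn hne hcont.continuousOn
  obtain ⟨q, hq, hqm⟩ := hK.exists_isMinOn hne hcont.continuousOn
  refine ⟨q, hq, p, hp, Subset.antisymm (fun x hx => ?_)
    ((convex_supportSet hA.2.2.1 _).segment_subset hq hp), fun x hx => ⟨hqm hx, hpm hx⟩⟩
  have h1 : inner ℝ (dir t) x = inner ℝ (dir t) q := le_antisymm (hq.2 _ hx.1) (hx.2 _ hq.1)
  have h2 : inner ℝ (dir t) p = inner ℝ (dir t) q := le_antisymm (hq.2 _ hp.1) (hp.2 _ hq.1)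
  have h3 : inner ℝ (tang t) x ∈ segment ℝ (inner ℝ (tang t) q) (inner ℝ (tang t) p) := by
    rw [segment_eq_Icc (hqm hp)]
    exact ⟨hqm hx, hpm hx⟩
  obtain ⟨c, d, hc, hd, hcd, h4⟩ := h3
  refine ⟨c, d, hc, hd, hcd, (sub_eq_zero.1 ?_)⟩
  simp only [smul_eq_mul] at h4
  refine eq_zero_of_inner_dir_tang (t := t) ?_ ?_ <;>
    rw [inner_sub_right, inner_add_right, inner_smul_right, inner_smul_right]
  · rw [h2, h1, ← add_mul, hcd, one_mul, sub_self]
  · rw [h4, sub_self]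

lemma bdryFun_eq_midpoint {t : ℝ} {q p : Plane} (h : supportSet A (dir t) = segment ℝ q p) :
    bdryFun A t = midpoint ℝ q p := by
  rw [bdryFun, h, segCenter_segment]

lemma bdryFun_mem_supportSet (hϑ : 0 < ϑ) (hϑ' : ϑ ≤ Real.pi / 2) (hA : A ∈ CV (sector ϑ))
    {t : ℝ} (ht : t ∈ Ioo (-ϑ) ϑ) : bdryFun A t ∈ supportSet A (dir t) := by
  obtain ⟨q, -, p, -, h, -⟩ := exists_supportSet_eq_segment hϑ hϑ' hA ht
  rw [bdryFun_eq_midpoint h, h]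
  exact midpoint_mem_segment q p

/-! ### The boundary curve -/

/-- The vectors between the directions `tang s` and `tang t`. -/
lemma norm_le_of_inner_dir {s t : ℝ} (hst : s ≤ t) (hsin : 0 < Real.sin (t - s)) {w : Plane}
    (hs : inner ℝ (dir s) w ≤ 0) (ht : 0 ≤ inner ℝ (dir t) w) {c : ℝ}
    (hc : c = (inner ℝ (dir t) w - inner ℝ (dir s) w) / Real.sin (t - s)) :
    ‖w‖ ≤ c ∧ ‖w - c • tang s‖ ≤ (t - s) * c := by
  have hc' : c * Real.sin (t - s) = inner ℝ (dir t) w - inner ℝ (dir s) w := by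
    rw [hc, div_mul_cancel₀ _ hsin.ne']
  set d := -inner ℝ (dir s) w / Real.sin (t - s) with hd
  have hd' : d * Real.sin (t - s) = -inner ℝ (dir s) w := by rw [hd, div_mul_cancel₀ _ hsin.ne']
  have hd0 : 0 ≤ d := div_nonneg (by linarith) hsin.le
  have hdc : d ≤ c := by rw [hd, hc]; gcongr; linarith
  have hw : w = (c - d) • tang s + d • tang t := by
    have h0 : Real.sin (t - s) ≠ 0 := hsin.ne'
    rw [inner_dir] at hd'
    rw [inner_dir, inner_dir] at hc'
    rw [Real.sin_sub] at hc' hd' h0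
    refine plane_ext (mul_left_cancel₀ h0 ?_) (mul_left_cancel₀ h0 ?_) <;>
      simp only [tang, PiLp.add_apply, PiLp.smul_apply, smul_eq_mul, Matrix.cons_val_zero,
        Matrix.cons_val_one]
    · linear_combination Real.sin s * hc' + (Real.sin t - Real.sin s) * hd'
    · linear_combination -Real.cos s * hc' + (Real.cos s - Real.cos t) * hd'
  constructor
  · calc ‖w‖ ≤ ‖(c - d) • tang s‖ + ‖d • tang t‖ := by
          conv_lhs => rw [hw]
          exact norm_add_le _ _
      _ = c := by
          rw [norm_smul, norm_smul, norm_tang, norm_tang, Real.norm_of_nonneg hd0,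
            Real.norm_of_nonneg (sub_nonneg.2 hdc)]
          ring
  · have h1 : w - c • tang s = d • (tang t - tang s) := by
      conv_lhs => rw [hw]
      module
    rw [h1, norm_smul, Real.norm_of_nonneg hd0, mul_comm]
    have h2 := norm_tang_sub_le t s
    rw [abs_of_nonneg (by linarith)] at h2
    gcongr

lemma inner_dir_bdryFun_sub (hϑ : 0 < ϑ) (hϑ' : ϑ ≤ Real.pi / 2) (hA : A ∈ CV (sector ϑ))
    {s t : ℝ} (hs : s ∈ Ioo (-ϑ) ϑ) (ht : t ∈ Ioo (-ϑ) ϑ) :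
    inner ℝ (dir s) (bdryFun A t - bdryFun A s) ≤ 0 ∧
      0 ≤ inner ℝ (dir t) (bdryFun A t - bdryFun A s) := by
  have h1 := bdryFun_mem_supportSet hϑ hϑ' hA hs
  have h2 := bdryFun_mem_supportSet hϑ hϑ' hA ht
  rw [inner_sub_right, inner_sub_right]
  exact ⟨by linarith [h1.2 _ h2.1], by linarith [h2.2 _ h1.1]⟩

lemma bdryFun_one_mono (hϑ : 0 < ϑ) (hϑ' : ϑ ≤ Real.pi / 2) (hA : A ∈ CV (sector ϑ)) :
    MonotoneOn (fun t => bdryFun A t 1) (Ioo (-ϑ) ϑ) := by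
  intro s hs t ht hst
  rcases hst.eq_or_lt with rfl | hlt
  · exact le_rfl
  have hsin := sin_sub_pos hϑ' hs ht hlt
  obtain ⟨h1, h2⟩ := inner_dir_bdryFun_sub hϑ hϑ' hA hs ht
  have hcs := cos_pos_of_mem hϑ' hs
  have hct := cos_pos_of_mem hϑ' ht
  -- The second unit coordinate vector times `sin (t - s)` is `cos s • dir t - cos t • dir s`.
  have key : Real.sin (t - s) * (bdryFun A t 1 - bdryFun A s 1) =
      Real.cos s * inner ℝ (dir t) (bdryFun A t - bdryFun A s) -
        Real.cos t * inner ℝ (dir s) (bdryFun A t - bdryFun A s) := by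
    rw [inner_dir, inner_dir, Real.sin_sub]; simp; ring
  have : 0 ≤ Real.sin (t - s) * (bdryFun A t 1 - bdryFun A s 1) := by
    rw [key]; nlinarith
  exact sub_nonneg.1 (nonneg_of_mul_nonneg_right this hsin)

@[simp] lemma bdryCurve_one (A : Set Plane) (y : ℝ) : bdryCurve A y 1 = y := by simp [bdryCurve]

lemma bdryCurve_mem (hϑ : 0 < ϑ) (hϑ' : ϑ ≤ Real.pi / 2) (hA : A ∈ CV (sector ϑ)) {y : ℝ}
    (hy : ∃ a ∈ A, a 1 = y) : bdryCurve A y ∈ A ∧ ∀ a ∈ A, a 1 = y → a 0 ≤ bdryCurve A y 0 := by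
  have hpl : ∀ a : Plane, a 1 = y → (!₂[a 0, y] : Plane) = a := fun a ha =>
    plane_ext (by simp) (by simp [ha])
  obtain ⟨M, hM⟩ := exists_inner_dir_le hϑ hϑ' hA (zero_mem_Ioo hϑ)
  have hbdd : BddAbove {x : ℝ | (!₂[x, y] : Plane) ∈ A} :=
    ⟨M, fun x hx => by simpa [inner_dir] using hM _ hx⟩
  have hcont : Continuous fun x : ℝ => (!₂[x, y] : Plane) := by
    refine (PiLp.continuous_toLp 2 _).comp (continuous_pi fun i => ?_)
    fin_cases i <;> simp <;> fun_prop
  obtain ⟨a, ha, hay⟩ := hy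
  have hne : {x : ℝ | (!₂[x, y] : Plane) ∈ A}.Nonempty := ⟨a 0, by
    show (!₂[a 0, y] : Plane) ∈ A
    rwa [hpl a hay]⟩
  refine ⟨(hA.2.1.preimage hcont).csSup_mem hne hbdd, fun b hb hby => ?_⟩
  refine le_csSup hbdd ?_
  show (!₂[b 0, y] : Plane) ∈ A
  rwa [hpl b hby]

/-- As `cos t > 0`, a point of `A` further right at the same height would beat the maximum in
direction `dir t`. -/
lemma bdryCurve_bdryFun (hϑ : 0 < ϑ) (hϑ' : ϑ ≤ Real.pi / 2) (hA : A ∈ CV (sector ϑ)) {t : ℝ}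
    (ht : t ∈ Ioo (-ϑ) ϑ) : bdryCurve A (bdryFun A t 1) = bdryFun A t := by
  have hH := bdryFun_mem_supportSet hϑ hϑ' hA ht
  obtain ⟨h1, h2⟩ := bdryCurve_mem hϑ hϑ' hA ⟨_, hH.1, rfl⟩
  refine plane_ext (le_antisymm ?_ (h2 _ hH.1 rfl)) (bdryCurve_one _ _)
  have h3 := hH.2 _ h1
  rw [inner_dir, inner_dir, bdryCurve_one] at h3
  exact le_of_mul_le_mul_left (by linarith) (cos_pos_of_mem hϑ' ht)

/-- A point of `A` at an intermediate height, between two given points of `A`. -/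
lemma exists_convex_comb {a b : Plane} {y : ℝ} (h1 : a 1 ≤ y) (h2 : y ≤ b 1) :
    ∃ c d : ℝ, 0 ≤ c ∧ 0 ≤ d ∧ c + d = 1 ∧ (c • a + d • b) 1 = y := by
  have : y ∈ segment ℝ (a 1) (b 1) := by
    rw [segment_eq_Icc (h1.trans h2)]; exact ⟨h1, h2⟩
  exact this

/-- The chord from `H_A(s)` to the curve point at `y'` meets height `y` at a point of `A`, weakly
left of the curve. Along `dir s` that point is at least as far as the end at `y'`, since `H_A(s)` is
maximal. -/
lemma inner_dir_bdryCurve_antitone (hϑ : 0 < ϑ) (hϑ' : ϑ ≤ Real.pi / 2) (hA : A ∈ CV (sector ϑ))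
    {s : ℝ} (hs : s ∈ Ioo (-ϑ) ϑ) {y y' : ℝ} (hy : bdryFun A s 1 ≤ y) (hyy' : y ≤ y')
    (hy' : ∃ a ∈ A, a 1 = y') :
    inner ℝ (dir s) (bdryCurve A y') ≤ inner ℝ (dir s) (bdryCurve A y) := by
  have hH := bdryFun_mem_supportSet hϑ hϑ' hA hs
  have hb := (bdryCurve_mem hϑ hϑ' hA hy').1
  obtain ⟨c, d, hc, hd, hcd, hz⟩ := exists_convex_comb (b := bdryCurve A y') hy (by simpa using hyy')
  have hzA := hA.2.2.1 hH.1 hb hc hd hcd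
  have h1 := (bdryCurve_mem hϑ hϑ' hA ⟨_, hzA, hz⟩).2 _ hzA hz
  have h2 : inner ℝ (dir s) (c • bdryFun A s + d • bdryCurve A y') ≤
      inner ℝ (dir s) (bdryCurve A y) := by
    rw [inner_dir, inner_dir, hz, bdryCurve_one]
    have := mul_le_mul_of_nonneg_left h1 (cos_pos_of_mem hϑ' hs).le
    linarith
  rw [inner_add_right, inner_smul_right, inner_smul_right] at h2
  have h3 := mul_le_mul_of_nonneg_left (hH.2 _ hb) hc
  have h4 : c * inner ℝ (dir s) (bdryCurve A y') + d * inner ℝ (dir s) (bdryCurve A y') =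
    inner ℝ (dir s) (bdryCurve A y') := by rw [← add_mul, hcd, one_mul]
  linarith

lemma inner_dir_bdryCurve_monotone (hϑ : 0 < ϑ) (hϑ' : ϑ ≤ Real.pi / 2) (hA : A ∈ CV (sector ϑ))
    {t : ℝ} (ht : t ∈ Ioo (-ϑ) ϑ) {y y' : ℝ} (hyy' : y ≤ y') (hy' : y' ≤ bdryFun A t 1)
    (hy : ∃ a ∈ A, a 1 = y) :
    inner ℝ (dir t) (bdryCurve A y) ≤ inner ℝ (dir t) (bdryCurve A y') := by
  have hH := bdryFun_mem_supportSet hϑ hϑ' hA ht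
  have hb := (bdryCurve_mem hϑ hϑ' hA hy).1
  obtain ⟨c, d, hc, hd, hcd, hz⟩ := exists_convex_comb (a := bdryCurve A y) (by simpa using hyy') hy'
  have hzA := hA.2.2.1 hb hH.1 hc hd hcd
  have h1 := (bdryCurve_mem hϑ hϑ' hA ⟨_, hzA, hz⟩).2 _ hzA hz
  have h2 : inner ℝ (dir t) (c • bdryCurve A y + d • bdryFun A t) ≤
      inner ℝ (dir t) (bdryCurve A y') := by
    rw [inner_dir, inner_dir, hz, bdryCurve_one]
    have := mul_le_mul_of_nonneg_left h1 (cos_pos_of_mem hϑ' ht).le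
    linarith
  rw [inner_add_right, inner_smul_right, inner_smul_right] at h2
  have h3 := mul_le_mul_of_nonneg_left (hH.2 _ hb) hd
  have h4 : c * inner ℝ (dir t) (bdryCurve A y) + d * inner ℝ (dir t) (bdryCurve A y) =
    inner ℝ (dir t) (bdryCurve A y) := by rw [← add_mul, hcd, one_mul]
  linarith

/-! ### Arc length -/

lemma eVariationOn_le_of_norm_le {E : Type*} [NormedAddCommGroup E] {γ : ℝ → E} {m : ℝ → ℝ}
    {S : Set ℝ} (h : ∀ x ∈ S, ∀ y ∈ S, x ≤ y → ‖γ y - γ x‖ ≤ m y - m x) {a b : ℝ} (ha : a ∈ S)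
    (hb : b ∈ S) : eVariationOn γ (S ∩ Icc a b) ≤ ENNReal.ofReal (m b - m a) := by
  have hm : MonotoneOn m S := fun x hx y hy hxy =>
    sub_nonneg.1 ((norm_nonneg _).trans (h x hx y hy hxy))
  refine le_trans ?_ (hm.eVariationOn_eq ha hb).le
  refine iSup_mono fun p => Finset.sum_le_sum fun i _ => ?_
  have hxy := p.2.2.1 (Nat.le_succ i)
  have hx := (p.2.2.2 i).1
  have hy := (p.2.2.2 (i + 1)).1
  rw [edist_dist, edist_dist, dist_eq_norm, Real.dist_eq]
  exact ENNReal.ofReal_le_ofReal ((h _ hx _ hy hxy).trans (le_abs_self _))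

/-- The arc is no shorter than its chord and no longer than the two tangent segments enclosing it.
Its increments lie in the cone spanned by `tang s` and `tang t`, where the norm is dominated by a
linear functional, and that functional telescopes. -/
lemma arcLength_bounds (hϑ : 0 < ϑ) (hϑ' : ϑ ≤ Real.pi / 2) (hA : A ∈ CV (sector ϑ))
    {s t : ℝ} (hs : s ∈ Ioo (-ϑ) ϑ) (ht : t ∈ Ioo (-ϑ) ϑ) (hst : s < t) :
    eVariationOn (bdryCurve A) (Icc (bdryFun A s 1) (bdryFun A t 1)) ≠ ⊤ ∧
    ‖bdryFun A t - bdryFun A s‖ ≤ arcLength A (bdryFun A s 1) (bdryFun A t 1) ∧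
    arcLength A (bdryFun A s 1) (bdryFun A t 1) ≤
      (inner ℝ (dir t) (bdryFun A t - bdryFun A s) -
        inner ℝ (dir s) (bdryFun A t - bdryFun A s)) / Real.sin (t - s) := by
  have hsin := sin_sub_pos hϑ' hs ht hst
  have hY : bdryFun A s 1 ≤ bdryFun A t 1 := bdryFun_one_mono hϑ hϑ' hA hs ht hst.le
  have hmem : ∀ y ∈ Icc (bdryFun A s 1) (bdryFun A t 1), ∃ a ∈ A, a 1 = y := fun y hy => by
    obtain ⟨c, d, hc, hd, hcd, hz⟩ := exists_convex_comb hy.1 hy.2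
    exact ⟨_, hA.2.2.1 (bdryFun_mem_supportSet hϑ hϑ' hA hs).1
      (bdryFun_mem_supportSet hϑ hϑ' hA ht).1 hc hd hcd, hz⟩
  have hle := eVariationOn_le_of_norm_le (γ := bdryCurve A)
    (m := fun y => (inner ℝ (dir t) (bdryCurve A y) - inner ℝ (dir s) (bdryCurve A y)) /
      Real.sin (t - s)) (S := Icc (bdryFun A s 1) (bdryFun A t 1)) (fun x hx y hy hxy => by
        refine (norm_le_of_inner_dir hst.le hsin (w := bdryCurve A y - bdryCurve A x) ?_ ?_ rfl).1.trans
          (le_of_eq ?_)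
        · rw [inner_sub_right, sub_nonpos]
          exact inner_dir_bdryCurve_antitone hϑ hϑ' hA hs hx.1 hxy (hmem y hy)
        · rw [inner_sub_right, sub_nonneg]
          exact inner_dir_bdryCurve_monotone hϑ hϑ' hA ht hxy hy.2 (hmem x hx)
        · rw [inner_sub_right, inner_sub_right]; ring) (left_mem_Icc.2 hY) (right_mem_Icc.2 hY)
  rw [inter_self, bdryCurve_bdryFun hϑ hϑ' hA hs, bdryCurve_bdryFun hϑ hϑ' hA ht] at hle
  have hfin := (hle.trans_lt ENNReal.ofReal_lt_top).ne
  refine ⟨hfin, ?_, ?_⟩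
  · have h := eVariationOn.edist_le (bdryCurve A) (right_mem_Icc.2 hY) (left_mem_Icc.2 hY)
    rw [bdryCurve_bdryFun hϑ hϑ' hA hs, bdryCurve_bdryFun hϑ hϑ' hA ht, edist_dist,
      dist_eq_norm] at h
    exact (ENNReal.ofReal_le_iff_le_toReal hfin).1 h
  · obtain ⟨h1, h2⟩ := inner_dir_bdryFun_sub hϑ hϑ' hA hs ht
    refine (ENNReal.toReal_mono ENNReal.ofReal_ne_top hle).trans ?_
    rw [ENNReal.toReal_ofReal]
    · rw [inner_sub_right, inner_sub_right]; apply le_of_eq; ring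
    · rw [inner_sub_right] at h1 h2
      rw [← sub_div]
      refine div_nonneg ?_ hsin.le
      linarith

lemma arcLength_self (A : Set Plane) (y : ℝ) : arcLength A y y = 0 := by
  rw [arcLength, Icc_self, eVariationOn.subsingleton _ subsingleton_singleton, ENNReal.toReal_zero]

lemma arcLength_add (hϑ : 0 < ϑ) (hϑ' : ϑ ≤ Real.pi / 2) (hA : A ∈ CV (sector ϑ))
    {r s t : ℝ} (hr : r ∈ Ioo (-ϑ) ϑ) (hs : s ∈ Ioo (-ϑ) ϑ) (ht : t ∈ Ioo (-ϑ) ϑ) (hrs : r ≤ s)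
    (hst : s ≤ t) : arcLength A (bdryFun A r 1) (bdryFun A s 1) +
      arcLength A (bdryFun A s 1) (bdryFun A t 1) = arcLength A (bdryFun A r 1) (bdryFun A t 1) := by
  rcases hrs.eq_or_lt with rfl | hrs
  · rw [arcLength_self, zero_add]
  rcases hst.eq_or_lt with rfl | hst
  · rw [arcLength_self, add_zero]
  rw [arcLength, arcLength, arcLength,
    ← ENNReal.toReal_add (arcLength_bounds hϑ hϑ' hA hr hs hrs).1
      (arcLength_bounds hϑ hϑ' hA hs ht hst).1]
  have := eVariationOn.Icc_add_Icc (bdryCurve A) (s := univ)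
    (bdryFun_one_mono hϑ hϑ' hA hr hs hrs.le) (bdryFun_one_mono hϑ hϑ' hA hs ht hst.le) (mem_univ _)
  simp only [univ_inter] at this
  rw [this]

lemma arcFun_sub (hϑ : 0 < ϑ) (hϑ' : ϑ ≤ Real.pi / 2) (hA : A ∈ CV (sector ϑ))
    {s t : ℝ} (hs : s ∈ Ioo (-ϑ) ϑ) (ht : t ∈ Ioo (-ϑ) ϑ) (hst : s ≤ t) :
    arcFun A t - arcFun A s = arcLength A (bdryFun A s 1) (bdryFun A t 1) := by
  have h0 := zero_mem_Ioo hϑ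
  rw [arcFun, arcFun]
  split_ifs with h1 h2 h2
  · linarith [arcLength_add hϑ hϑ' hA h0 hs ht h2 hst]
  · linarith [arcLength_add hϑ hϑ' hA hs h0 ht (not_le.1 h2).le h1]
  · linarith
  · linarith [arcLength_add hϑ hϑ' hA hs ht h0 hst (not_le.1 h1).le]

lemma isNondecr_arcFun (hϑ : 0 < ϑ) (hϑ' : ϑ ≤ Real.pi / 2) (hA : A ∈ CV (sector ϑ)) :
    IsNondecr ϑ (arcFun A) := by
  refine ⟨fun s hs t ht hst => ?_, ?_⟩
  · rw [← sub_nonneg, arcFun_sub hϑ hϑ' hA hs ht hst]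
    exact ENNReal.toReal_nonneg
  · rw [arcFun, if_pos le_rfl, arcLength_self]

/-- With chord `w`, arc length `l` and tangent length `c`, one has `‖w‖ ≤ l ≤ c` and `‖w - c • tang
s‖ ≤ (t - s) * c`, so `c - l ≤ (t - s) * c` and the defect is at most `2 (t - s) c`. For steps up to
`1/2` this also gives `c ≤ 2 l`, whence the factor `4`; for longer steps the trivial bound `2 l`
suffices. -/
lemma tangentialOn_bdryFun (hϑ : 0 < ϑ) (hϑ' : ϑ ≤ Real.pi / 2) (hA : A ∈ CV (sector ϑ)) :
    TangentialOn ϑ (bdryFun A) (arcFun A) (fun t => 4 * arcFun A t) := by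
  intro s hs t ht hst
  rcases hst.eq_or_lt with rfl | hst
  · simp
  obtain ⟨-, h1, h2⟩ := arcLength_bounds hϑ hϑ' hA hs ht hst
  obtain ⟨h3, h4⟩ := inner_dir_bdryFun_sub hϑ hϑ' hA hs ht
  have h5 := norm_le_of_inner_dir hst.le (sin_sub_pos hϑ' hs ht hst) h3 h4 rfl
  rw [← mul_sub, arcFun_sub hϑ hϑ' hA hs ht hst.le]
  set c := (inner ℝ (dir t) (bdryFun A t - bdryFun A s) -
        inner ℝ (dir s) (bdryFun A t - bdryFun A s)) / Real.sin (t - s)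
  set l := arcLength A (bdryFun A s 1) (bdryFun A t 1)
  set w := bdryFun A t - bdryFun A s
  have hc0 : 0 ≤ c := (norm_nonneg _).trans h5.1
  have hl0 : 0 ≤ l := (norm_nonneg _).trans h1
  have hts : 0 < t - s := sub_pos.2 hst
  rcases le_total (t - s) (1 / 2) with hsmall | hbig
  · have h6 : ‖c • tang s‖ ≤ ‖w‖ + (t - s) * c := by
      calc ‖c • tang s‖ = ‖w - (w - c • tang s)‖ := by rw [sub_sub_cancel]
        _ ≤ _ := (norm_sub_le _ _).trans (by linarith [h5.2])
    rw [norm_smul, norm_tang, mul_one, Real.norm_of_nonneg hc0] at h6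
    have h7 : c ≤ 2 * l := by nlinarith
    calc ‖w - l • tang s‖ = ‖(w - c • tang s) + (c - l) • tang s‖ := by congr 1; module
      _ ≤ (t - s) * c + (c - l) := by
          refine (norm_add_le _ _).trans (add_le_add h5.2 ?_)
          rw [norm_smul, norm_tang, mul_one, Real.norm_of_nonneg (by linarith)]
      _ ≤ (t - s) * (4 * l) := by nlinarith
  · calc ‖w - l • tang s‖ ≤ ‖w‖ + ‖l • tang s‖ := norm_sub_le _ _
      _ ≤ l + l := by
          rw [norm_smul, norm_tang, mul_one, Real.norm_of_nonneg hl0]; linarith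
      _ ≤ (t - s) * (4 * l) := by nlinarith

lemma bdryFun_eq (hϑ : 0 < ϑ) (hϑ' : ϑ ≤ Real.pi / 2) (hA : A ∈ CV (sector ϑ)) {t : ℝ}
    (ht : t ∈ Ioo (-ϑ) ϑ) : bdryFun A t = bdryFun A 0 + genFun (arcFun A) t := by
  rw [(tangentialOn_bdryFun hϑ hϑ' hA).genFun_eq hϑ (by norm_num)
    (isNondecr_arcFun hϑ hϑ' hA).1 ht, add_sub_cancel]

/-! ### One-sided limits -/

lemma exists_tendsto_right {f : ℝ → ℝ} (hf : MonotoneOn f (Ioo (-ϑ) ϑ)) {t : ℝ}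
    (ht : t ∈ Ioo (-ϑ) ϑ) : ∃ r, Tendsto f (𝓝[>] t) (𝓝 r) :=
  ⟨_, MonotoneOn.tendsto_nhdsWithin_Ioo_right (nonempty_Ioo.2 ht.2)
    (hf.mono (Ioo_subset_Ioo_left ht.1.le)) ⟨f t, by
      rintro _ ⟨x, hx, rfl⟩
      exact hf ht ⟨ht.1.trans hx.1, hx.2⟩ hx.1.le⟩⟩

lemma exists_tendsto_left {f : ℝ → ℝ} (hf : MonotoneOn f (Ioo (-ϑ) ϑ)) {t : ℝ}
    (ht : t ∈ Ioo (-ϑ) ϑ) : ∃ l, Tendsto f (𝓝[<] t) (𝓝 l) :=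
  ⟨_, MonotoneOn.tendsto_nhdsWithin_Ioo_left (nonempty_Ioo.2 ht.1)
    (hf.mono (Ioo_subset_Ioo_right ht.2.le)) ⟨f t, by
      rintro _ ⟨x, hx, rfl⟩
      exact hf ⟨hx.1, hx.2.trans ht.2⟩ ht hx.2.le⟩⟩

lemma TangentialOn.tendsto_right {H : ℝ → Plane} {f : ℝ → ℝ} {C : ℝ}
    (hH : TangentialOn ϑ H f fun t => C * f t) {t r : ℝ} (ht : t ∈ Ioo (-ϑ) ϑ)
    (hr : Tendsto f (𝓝[>] t) (𝓝 r)) : Tendsto H (𝓝[>] t) (𝓝 (H t + (r - f t) • tang t)) := by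
  have hid : Tendsto (fun x : ℝ => x) (𝓝[>] t) (𝓝 t) := nhdsWithin_le_nhds
  have hb : Tendsto (fun x => (x - t) * (C * f x - C * f t)) (𝓝[>] t) (𝓝 0) := by
    simpa using (hid.sub_const t).mul ((hr.const_mul C).sub_const (C * f t))
  have hz : Tendsto (fun x => H x - H t - (f x - f t) • tang t) (𝓝[>] t) (𝓝 0) := by
    refine squeeze_zero_norm' ?_ hb
    filter_upwards [Ioo_mem_nhdsGT ht.2] with x hx
    exact hH t ht x ⟨ht.1.trans hx.1, hx.2⟩ hx.1.le
  have := (hz.add ((hr.sub_const (f t)).smul_const (tang t))).const_add (H t)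
  rw [zero_add] at this
  exact this.congr fun x => by abel

/-- The defect is based at the left end of each step, here the moving point `x`, so continuity of
`tang` enters, unlike on the right. -/
lemma TangentialOn.tendsto_left {H : ℝ → Plane} {f : ℝ → ℝ} {C : ℝ}
    (hH : TangentialOn ϑ H f fun t => C * f t) {t l : ℝ} (ht : t ∈ Ioo (-ϑ) ϑ)
    (hl : Tendsto f (𝓝[<] t) (𝓝 l)) : Tendsto H (𝓝[<] t) (𝓝 (H t - (f t - l) • tang t)) := by
  have hid : Tendsto (fun x : ℝ => x) (𝓝[<] t) (𝓝 t) := nhdsWithin_le_nhds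
  have hb : Tendsto (fun x => (t - x) * (C * f t - C * f x)) (𝓝[<] t) (𝓝 0) := by
    simpa using (hid.const_sub t).mul ((hl.const_mul C).const_sub (C * f t))
  have hz : Tendsto (fun x => H t - H x - (f t - f x) • tang x) (𝓝[<] t) (𝓝 0) := by
    refine squeeze_zero_norm' ?_ hb
    filter_upwards [Ioo_mem_nhdsLT ht.1] with x hx
    exact hH x ⟨hx.1, hx.2.trans ht.2⟩ t ht hx.2.le
  have htang : Tendsto tang (𝓝[<] t) (𝓝 (tang t)) := (continuous_tang.tendsto t).comp hid
  have := (hz.add ((hl.const_sub (f t)).smul htang)).const_sub (H t)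
  rw [zero_add] at this
  exact this.congr fun x => by abel

lemma inner_dir_eq (s t : ℝ) (w : Plane) : inner ℝ (dir s) w =
    Real.cos (s - t) * inner ℝ (dir t) w + Real.sin (s - t) * inner ℝ (tang t) w := by
  rw [inner_dir, inner_dir, inner_tang]
  obtain ⟨d, rfl⟩ : ∃ d, s = t + d := ⟨s - t, by ring⟩
  rw [add_sub_cancel_left, Real.cos_add, Real.sin_add]
  ring

/-- The one-sided limits `P`, `Q` of `H_A` at `t` are the end points of the support segment, and
they differ from its center by the one-sided jumps of the arc length times `tang t`. The center
being the midpoint, the two jumps are equal. -/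
lemma isMidvalued_arcFun (hϑ : 0 < ϑ) (hϑ' : ϑ ≤ Real.pi / 2) (hA : A ∈ CV (sector ϑ)) :
    IsMidvalued ϑ (arcFun A) := by
  intro t ht
  have hf := (isNondecr_arcFun hϑ hϑ' hA).1
  have hH := tangentialOn_bdryFun hϑ hϑ' hA
  obtain ⟨r, hr⟩ := exists_tendsto_right hf ht
  obtain ⟨l, hl⟩ := exists_tendsto_left hf ht
  refine ⟨r, l, hr, hl, ?_⟩
  have hP := hH.tendsto_right ht hr
  have hQ := hH.tendsto_left ht hl
  set P := bdryFun A t + (r - arcFun A t) • tang t with hPdef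
  set Q := bdryFun A t - (arcFun A t - l) • tang t with hQdef
  have hHt := bdryFun_mem_supportSet hϑ hϑ' hA ht
  have htt : inner ℝ (tang t) (tang t) = (1 : ℝ) := by
    rw [real_inner_self_eq_norm_sq, norm_tang, one_pow]
  have hdt : inner ℝ (dir t) (tang t) = (0 : ℝ) := by rw [inner_dir_tang, sub_self, Real.sin_zero]
  have hPS : P ∈ supportSet A (dir t) := by
    refine ⟨hA.2.1.mem_of_tendsto hP ?_, fun b hb => ?_⟩
    · filter_upwards [Ioo_mem_nhdsGT ht.2] with x hx
      exact (bdryFun_mem_supportSet hϑ hϑ' hA ⟨ht.1.trans hx.1, hx.2⟩).1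
    · rw [hPdef, inner_add_right, inner_smul_right, hdt, mul_zero, add_zero]
      exact hHt.2 b hb
  have hQS : Q ∈ supportSet A (dir t) := by
    refine ⟨hA.2.1.mem_of_tendsto hQ ?_, fun b hb => ?_⟩
    · filter_upwards [Ioo_mem_nhdsLT ht.1] with x hx
      exact (bdryFun_mem_supportSet hϑ hϑ' hA ⟨hx.1, hx.2.trans ht.2⟩).1
    · rw [hQdef, inner_sub_right, inner_smul_right, hdt, mul_zero, sub_zero]
      exact hHt.2 b hb
  -- For `y` slightly above `t`, `dir y` is a nonnegative combination of `dir t` and `tang t`.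
  -- `H_A(y)` is at least as far as `x` along `dir y` and at most as far along `dir t`, so it is at
  -- least as far along `tang t`.
  have hPmax : ∀ x ∈ supportSet A (dir t), inner ℝ (tang t) x ≤ inner ℝ (tang t) P := by
    intro x hx
    refine ge_of_tendsto ((tendsto_const_nhds (x := tang t)).inner hP) ?_
    filter_upwards [Ioo_mem_nhdsGT ht.2,
      Ioo_mem_nhdsGT (show t < t + Real.pi / 2 by linarith [Real.pi_pos])] with y hy hy'
    have hyI : y ∈ Ioo (-ϑ) ϑ := ⟨ht.1.trans hy.1, hy.2⟩
    have hyS := bdryFun_mem_supportSet hϑ hϑ' hA hyI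
    have h1 := hyS.2 x hx.1
    have h2 := hx.2 _ hyS.1
    rw [inner_dir_eq y t, inner_dir_eq y t (bdryFun A y)] at h1
    have hsin := sin_sub_pos hϑ' ht hyI hy.1
    have hcos : 0 ≤ Real.cos (y - t) :=
      Real.cos_nonneg_of_mem_Icc ⟨by linarith [hy.1, Real.pi_pos], by linarith [hy'.2]⟩
    have := mul_le_mul_of_nonneg_left h2 hcos
    exact le_of_mul_le_mul_left (by linarith) hsin
  have hQmin : ∀ x ∈ supportSet A (dir t), inner ℝ (tang t) Q ≤ inner ℝ (tang t) x := by
    intro x hx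
    refine le_of_tendsto ((tendsto_const_nhds (x := tang t)).inner hQ) ?_
    filter_upwards [Ioo_mem_nhdsLT ht.1,
      Ioo_mem_nhdsLT (show t - Real.pi / 2 < t by linarith [Real.pi_pos])] with y hy hy'
    have hyI : y ∈ Ioo (-ϑ) ϑ := ⟨hy.1, hy.2.trans ht.2⟩
    have hyS := bdryFun_mem_supportSet hϑ hϑ' hA hyI
    have h1 := hyS.2 x hx.1
    have h2 := hx.2 _ hyS.1
    rw [inner_dir_eq y t, inner_dir_eq y t (bdryFun A y)] at h1
    have hsin := sin_sub_pos hϑ' hyI ht hy.2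
    rw [← neg_sub, Real.sin_neg] at hsin
    have hcos : 0 ≤ Real.cos (y - t) :=
      Real.cos_nonneg_of_mem_Icc ⟨by linarith [hy'.1], by linarith [hy.2, Real.pi_pos]⟩
    have := mul_le_mul_of_nonneg_left h2 hcos
    exact le_of_mul_le_mul_left (by linarith) hsin
  obtain ⟨q, hq, p, hp, hseg, hqp⟩ := exists_supportSet_eq_segment hϑ hϑ' hA ht
  have e1 : inner ℝ (tang t) P = inner ℝ (tang t) p := le_antisymm (hqp P hPS).2 (hPmax p hp)
  have e2 : inner ℝ (tang t) Q = inner ℝ (tang t) q := le_antisymm (hQmin q hq) (hqp Q hQS).1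
  have e3 : inner ℝ (tang t) (bdryFun A t) = (inner ℝ (tang t) q + inner ℝ (tang t) p) / 2 := by
    rw [bdryFun_eq_midpoint hseg, midpoint_eq_smul_add, inner_smul_right, inner_add_right]
    simp only [invOf_eq_inv]; ring
  rw [hPdef, inner_add_right, inner_smul_right, htt] at e1
  rw [hQdef, inner_sub_right, inner_smul_right, htt] at e2
  linarith

end

/-! ### Infima -/

section
variable {ϑ : ℝ} {f g h c d m : ℝ → ℝ}

/-- The signed variation of `f - g` from `0`. -/
noncomputable def diffVar (ϑ : ℝ) (f g : ℝ → ℝ) (t : ℝ) : ℝ :=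
  variationOnFromTo (fun x => f x - g x) (Ioo (-ϑ) ϑ) 0 t

lemma locallyBoundedVariationOn_of_abs_le
    (hd : ∀ x ∈ Ioo (-ϑ) ϑ, ∀ y ∈ Ioo (-ϑ) ϑ, x ≤ y → |d y - d x| ≤ m y - m x) :
    LocallyBoundedVariationOn d (Ioo (-ϑ) ϑ) := fun _ _ ha hb =>
  ((eVariationOn_le_of_norm_le hd ha hb).trans_lt ENNReal.ofReal_lt_top).ne

lemma abs_sub_le_of_monotoneOn (hc : MonotoneOn c (Ioo (-ϑ) ϑ)) (hd : MonotoneOn d (Ioo (-ϑ) ϑ)) :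
    ∀ x ∈ Ioo (-ϑ) ϑ, ∀ y ∈ Ioo (-ϑ) ϑ, x ≤ y →
      |(c y - d y) - (c x - d x)| ≤ (c y + d y) - (c x + d x) := fun x hx y hy hxy => by
  have h1 := hc hx hy hxy
  have h2 := hd hx hy hxy
  rw [abs_le]
  constructor <;> linarith

lemma diffVar_sub (hϑ : 0 < ϑ)
    (hfg : LocallyBoundedVariationOn (fun x => f x - g x) (Ioo (-ϑ) ϑ)) {s t : ℝ}
    (hs : s ∈ Ioo (-ϑ) ϑ) (ht : t ∈ Ioo (-ϑ) ϑ) (hst : s ≤ t) : diffVar ϑ f g t - diffVar ϑ f g s =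
      (eVariationOn (fun x => f x - g x) (Ioo (-ϑ) ϑ ∩ Icc s t)).toReal := by
  rw [diffVar, diffVar, variationOnFromTo.sub_right hfg (zero_mem_Ioo hϑ) ht hs,
    variationOnFromTo.eq_of_le _ _ hst]

/-- A function whose increments dominate those of `f - g` dominates the variation of `f - g`. -/
lemma monotoneOn_sub_diffVar (hϑ : 0 < ϑ)
    (hm : ∀ x ∈ Ioo (-ϑ) ϑ, ∀ y ∈ Ioo (-ϑ) ϑ, x ≤ y →
      |(f y - g y) - (f x - g x)| ≤ m y - m x) :
    MonotoneOn (fun t => m t - diffVar ϑ f g t) (Ioo (-ϑ) ϑ) := by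
  intro s hs t ht hst
  have h1 := diffVar_sub hϑ (locallyBoundedVariationOn_of_abs_le (d := fun x => f x - g x) hm)
    hs ht hst
  have h2 := eVariationOn_le_of_norm_le (γ := fun x => f x - g x) hm hs ht
  have h3 := ENNReal.toReal_mono ENNReal.ofReal_ne_top h2
  rw [ENNReal.toReal_ofReal ((abs_nonneg _).trans (hm s hs t ht hst)), ← h1] at h3
  show m s - diffVar ϑ f g s ≤ m t - diffVar ϑ f g t
  linarith

lemma abs_sub_le_diffVar (hϑ : 0 < ϑ)
    (hfg : LocallyBoundedVariationOn (fun x => f x - g x) (Ioo (-ϑ) ϑ)) {s t : ℝ}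
    (hs : s ∈ Ioo (-ϑ) ϑ) (ht : t ∈ Ioo (-ϑ) ϑ) (hst : s ≤ t) :
    |(f t - g t) - (f s - g s)| ≤ diffVar ϑ f g t - diffVar ϑ f g s := by
  rw [diffVar_sub hϑ hfg hs ht hst]
  have h1 := eVariationOn.edist_le (fun x => f x - g x) (s := Ioo (-ϑ) ϑ ∩ Icc s t)
    ⟨ht, right_mem_Icc.2 hst⟩ ⟨hs, left_mem_Icc.2 hst⟩
  rw [edist_dist, Real.dist_eq] at h1
  exact (ENNReal.ofReal_le_iff_le_toReal (hfg _ _ hs ht)).1 h1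

/-- The infimum of two non-decreasing functions. -/
noncomputable def infFun (ϑ : ℝ) (f g : ℝ → ℝ) (t : ℝ) : ℝ := (f t + g t - diffVar ϑ f g t) / 2

/-- This is `min a b = (a + b - |a - b|) / 2` at the level of increments. If `k` precedes both, the
increments of `(f - k) + (g - k)` dominate those of `f - g`, hence its variation. -/
lemma isInfimum_infFun (hϑ : 0 < ϑ) (hf : IsNondecr ϑ f) (hg : IsNondecr ϑ g) :
    IsInfimum ϑ f g (infFun ϑ f g) := by
  have hfg := locallyBoundedVariationOn_of_abs_le (d := fun x => f x - g x)
    (abs_sub_le_of_monotoneOn hf.1 hg.1)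
  refine ⟨⟨⟨fun s hs t ht hst => ?_, ?_⟩, fun s hs t ht hst => ?_, fun s hs t ht hst => ?_⟩,
    fun k hk hkf hkg s hs t ht hst => ?_⟩
  · have := monotoneOn_sub_diffVar hϑ (abs_sub_le_of_monotoneOn hf.1 hg.1) hs ht hst
    simp only [infFun] at this ⊢
    linarith
  · simp [infFun, diffVar, variationOnFromTo.self, hf.2, hg.2]
  · have := neg_le_of_abs_le (abs_sub_le_diffVar hϑ hfg hs ht hst)
    simp only [infFun]
    linarith
  · have := le_of_abs_le (abs_sub_le_diffVar hϑ hfg hs ht hst)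
    simp only [infFun]
    linarith
  · have := monotoneOn_sub_diffVar (f := f) (g := g)
      (m := fun t => (f t - k t) + (g t - k t)) hϑ (fun x hx y hy hxy => by
        have h1 := abs_sub_le_of_monotoneOn hkf hkg x hx y hy hxy
        rwa [show f y - k y - (g y - k y) - (f x - k x - (g x - k x)) =
          f y - g y - (f x - g x) by ring] at h1) hs ht hst
    simp only [infFun] at this ⊢
    linarith

lemma IsInfimum.eq_infFun (hϑ : 0 < ϑ) (hf : IsNondecr ϑ f) (hg : IsNondecr ϑ g)
    (hh : IsInfimum ϑ f g h) {t : ℝ} (ht : t ∈ Ioo (-ϑ) ϑ) : h t = infFun ϑ f g t := by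
  have hi := isInfimum_infFun hϑ hf hg
  have h1 := hh.2 _ hi.1.1 hi.1.2.1 hi.1.2.2
  have h2 := hi.2 _ hh.1.1 hh.1.2.1 hh.1.2.2
  have h0 := zero_mem_Ioo hϑ
  have e1 := hh.1.1.2
  have e2 := hi.1.1.2
  rcases le_total 0 t with hle | hle
  · have a1 := h1 h0 ht hle
    have a2 := h2 h0 ht hle
    simp only [e1, e2] at a1 a2
    linarith
  · have a1 := h1 ht h0 hle
    have a2 := h2 ht h0 hle
    simp only [e1, e2] at a1 a2
    linarith

/-- If `f + d = g + c` then `d` exceeds `g - inf(f, g)`. -/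
lemma IsInfimum.monotoneOn_sub (hϑ : 0 < ϑ) (hf : IsNondecr ϑ f) (hg : IsNondecr ϑ g)
    (hh : IsInfimum ϑ f g h) (hc : IsNondecr ϑ c) (hd : IsNondecr ϑ d)
    (heq : ∀ t ∈ Ioo (-ϑ) ϑ, f t + d t = g t + c t) :
    MonotoneOn (fun t => d t - (g t - h t)) (Ioo (-ϑ) ϑ) := by
  intro s hs t ht hst
  have := monotoneOn_sub_diffVar (f := f) (g := g) (m := fun t => c t + d t) hϑ
    (fun x hx y hy hxy => by
      have h1 := abs_sub_le_of_monotoneOn hc.1 hd.1 x hx y hy hxy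
      rwa [show c y - d y - (c x - d x) = f y - g y - (f x - g x) by
        linarith [heq x hx, heq y hy]] at h1) hs ht hst
  simp only [hh.eq_infFun hϑ hf hg hs, hh.eq_infFun hϑ hf hg ht, infFun] at this ⊢
  linarith [heq s hs, heq t ht]

/-! ### Midvalued functions -/

lemma IsMidvalued.sub (hf : IsMidvalued ϑ f) (hg : IsMidvalued ϑ g) :
    IsMidvalued ϑ fun t => f t - g t := by
  intro t ht
  obtain ⟨r, l, hr, hl, h⟩ := hf t ht
  obtain ⟨r', l', hr', hl', h'⟩ := hg t ht
  exact ⟨r - r', l - l', hr.sub hr', hl.sub hl', by simp only [h, h']; ring⟩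

/-- Replacing a value of a non-decreasing function by the mean of the one-sided limits. -/
lemma monotoneOn_update_mid (hf : MonotoneOn f (Ioo (-ϑ) ϑ)) {t r l : ℝ} (ht : t ∈ Ioo (-ϑ) ϑ)
    (hr : Tendsto f (𝓝[>] t) (𝓝 r)) (hl : Tendsto f (𝓝[<] t) (𝓝 l)) :
    MonotoneOn (Function.update f t ((r + l) / 2)) (Ioo (-ϑ) ϑ) := by
  have h1 : f t ≤ r := by
    refine ge_of_tendsto hr ?_
    filter_upwards [Ioo_mem_nhdsGT ht.2] with x hx
    exact hf ht ⟨ht.1.trans hx.1, hx.2⟩ hx.1.le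
  have h2 : l ≤ f t := by
    refine le_of_tendsto hl ?_
    filter_upwards [Ioo_mem_nhdsLT ht.1] with x hx
    exact hf ⟨hx.1, hx.2.trans ht.2⟩ ht hx.2.le
  have h3 : ∀ x ∈ Ioo (-ϑ) ϑ, t < x → r ≤ f x := fun x hx htx => by
    refine le_of_tendsto hr ?_
    filter_upwards [Ioo_mem_nhdsGT htx] with y hy
    exact hf ⟨ht.1.trans hy.1, hy.2.trans hx.2⟩ hx hy.2.le
  have h4 : ∀ x ∈ Ioo (-ϑ) ϑ, x < t → f x ≤ l := fun x hx htx => by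
    refine ge_of_tendsto hl ?_
    filter_upwards [Ioo_mem_nhdsLT htx] with y hy
    exact hf hx ⟨hx.1.trans hy.1, hy.2.trans ht.2⟩ hy.1.le
  intro x hx y hy hxy
  by_cases hxt : x = t <;> by_cases hyt : y = t
  · rw [hxt, hyt]
  · subst hxt
    rw [Function.update_self, Function.update_of_ne hyt]
    linarith [h3 y hy (lt_of_le_of_ne hxy (Ne.symm hyt))]
  · subst hyt
    rw [Function.update_self, Function.update_of_ne hxt]
    linarith [h4 x hx (lt_of_le_of_ne hxy hxt)]
  · rw [Function.update_of_ne hxt, Function.update_of_ne hyt]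
    exact hf hx hy hxy

/-- Replacing `h t` by the mean of its one-sided limits gives another lower bound, because `f` and
`g` are midvalued. Then `h` minus the new function is non-decreasing but takes equal values on both
sides of `t`, so nothing changed at `t`. -/
lemma IsInfimum.isMidvalued (hh : IsInfimum ϑ f g h) (hf : IsMidvalued ϑ f)
    (hg : IsMidvalued ϑ g) : IsMidvalued ϑ h := by
  intro t ht
  obtain ⟨⟨hhm, -⟩, hhf, hhg⟩ := hh.1
  obtain ⟨r, hr⟩ := exists_tendsto_right hhm ht
  obtain ⟨l, hl⟩ := exists_tendsto_left hhm ht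
  refine ⟨r, l, hr, hl, ?_⟩
  set u := Function.update h t ((r + l) / 2) with hu
  -- Subtracting `u 0` restores the normalization at `0` when `t = 0`.
  have hprec : ∀ φ : ℝ → ℝ, IsMidvalued ϑ φ → Precedes ϑ h φ →
      Precedes ϑ (fun x => u x - u 0) φ := by
    intro φ hφ hpre
    obtain ⟨r', l', hr', hl', hφt⟩ := hφ t ht
    have h1 := monotoneOn_update_mid hpre ht (hr'.sub hr) (hl'.sub hl)
    have h2 : ∀ x, Function.update (fun x => φ x - h x) t ((r' - r + (l' - l)) / 2) x =
        φ x - u x := by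
      intro x
      rcases eq_or_ne x t with rfl | hx
      · rw [hu, Function.update_self, Function.update_self, hφt]; ring
      · rw [hu, Function.update_of_ne hx, Function.update_of_ne hx]
    intro x hx y hy hxy
    have h3 := h1 hx hy hxy
    rw [h2, h2] at h3
    show φ x - (u x - u 0) ≤ φ y - (u y - u 0)
    linarith
  have hmain := hh.2 (fun x => u x - u 0)
    ⟨fun x hx y hy hxy => sub_le_sub_right (monotoneOn_update_mid hhm ht hr hl hx hy hxy) _,
      sub_self _⟩ (hprec f hf hhf) (hprec g hg hhg)
  obtain ⟨a, ha1, ha2⟩ := exists_between ht.1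
  obtain ⟨b, hb1, hb2⟩ := exists_between ht.2
  have e1 := hmain ⟨ha1, ha2.trans ht.2⟩ ht ha2.le
  have e2 := hmain ht ⟨ht.1.trans hb1, hb2⟩ hb1.le
  have ua : u a = h a := Function.update_of_ne ha2.ne _ _
  have ub : u b = h b := Function.update_of_ne hb1.ne' _ _
  have ut : u t = (r + l) / 2 := Function.update_self _ _ _
  simp only [ua, ub, ut] at e1 e2
  linarith

end

/-! ### Sums of members of `C_V` -/

section
variable {ϑ : ℝ} {A B C D : Set Plane} {f g : ℝ → ℝ}

lemma mem_of_forall_exists_inner_dir_le (hϑ : 0 < ϑ) (hϑ' : ϑ ≤ Real.pi / 2)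
    (hA : A ∈ CV (sector ϑ)) {x : Plane}
    (hx : ∀ t ∈ Ioo (-ϑ) ϑ, ∃ a ∈ A, inner ℝ (dir t) x ≤ inner ℝ (dir t) a) : x ∈ A := by
  have hr := hA.2.2.2
  refine mem_of_forall_inner_dir_le hϑ hϑ' hA.2.1 hA.2.2.1 hA.1
    (fun v hv k hk => by rw [← hr] at hv; exact hv k hk)
    (exists_inner_dir_le hϑ hϑ' hA (zero_mem_Ioo hϑ))
    (s := fun t => inner ℝ (dir t) x) (fun t ht c hc => ?_) fun t _ => le_rfl
  obtain ⟨a, ha, hle⟩ := hx t ht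
  exact hle.trans (hc a ha)

lemma add_mem_CV (hϑ : 0 < ϑ) (hϑ' : ϑ ≤ Real.pi / 2) (hA : A ∈ CV (sector ϑ))
    (hB : B ∈ CV (sector ϑ)) : A + B ∈ CV (sector ϑ) := by
  refine ⟨hA.1.add hB.1, isClosed_add_of_mem_CV hϑ hϑ' hA hB, hA.2.2.1.add hB.2.2.1,
    Subset.antisymm (fun w hw => mem_sector_of_add_mem hϑ hϑ' (hA.1.add hB.1)
      (s := fun t => inner ℝ (dir t) (bdryFun A t + bdryFun B t)) (fun t ht x hx => ?_) hw) ?_⟩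
  · obtain ⟨a, ha, b, hb, rfl⟩ := hx
    rw [inner_add_right, inner_add_right]
    exact add_le_add ((bdryFun_mem_supportSet hϑ hϑ' hA ht).2 a ha)
      ((bdryFun_mem_supportSet hϑ hϑ' hB ht).2 b hb)
  · rintro w hw _ ⟨a, ha, b, hb, rfl⟩
    rw [← hA.2.2.2] at hw
    exact ⟨w + a, hw a ha, b, hb, add_assoc _ _ _⟩

lemma supportSet_add_subset (u : Plane) (hA : (supportSet A u).Nonempty)
    (hB : (supportSet B u).Nonempty) :
    supportSet (A + B) u ⊆ supportSet A u + supportSet B u := by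
  rintro _ ⟨⟨a, ha, b, hb, rfl⟩, h⟩
  obtain ⟨p, hp⟩ := hA
  obtain ⟨q, hq⟩ := hB
  have h1 := h _ (add_mem_add hp.1 hq.1)
  simp only [inner_add_right] at h1
  have h2 := hp.2 a ha
  have h3 := hq.2 b hb
  exact ⟨a, ⟨ha, fun x hx => (hp.2 x hx).trans (by linarith)⟩, b,
    ⟨hb, fun x hx => (hq.2 x hx).trans (by linarith)⟩, rfl⟩

lemma add_mem_supportSet {u p q : Plane} (hp : p ∈ supportSet A u) (hq : q ∈ supportSet B u) :
    p + q ∈ supportSet (A + B) u := by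
  refine ⟨add_mem_add hp.1 hq.1, ?_⟩
  rintro _ ⟨a, ha, b, hb, rfl⟩
  rw [inner_add_right, inner_add_right]
  exact add_le_add (hp.2 a ha) (hq.2 b hb)

/-- Support sets add, the extreme points along `tang t` add, and therefore so do the midpoints. -/
lemma bdryFun_add (hϑ : 0 < ϑ) (hϑ' : ϑ ≤ Real.pi / 2) (hA : A ∈ CV (sector ϑ))
    (hB : B ∈ CV (sector ϑ)) {t : ℝ} (ht : t ∈ Ioo (-ϑ) ϑ) :
    bdryFun (A + B) t = bdryFun A t + bdryFun B t := by
  obtain ⟨q, hq, p, hp, hs, hm⟩ := exists_supportSet_eq_segment hϑ hϑ' hA ht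
  obtain ⟨q', hq', p', hp', hs', hm'⟩ := exists_supportSet_eq_segment hϑ hϑ' hB ht
  obtain ⟨q₂, hq₂, p₂, hp₂, hs₂, hm₂⟩ :=
    exists_supportSet_eq_segment hϑ hϑ' (add_mem_CV hϑ hϑ' hA hB) ht
  have hP := add_mem_supportSet hp hp'
  have hQ := add_mem_supportSet hq hq'
  have heq : ∀ x ∈ supportSet (A + B) (dir t), ∀ y ∈ supportSet (A + B) (dir t),
      inner ℝ (tang t) x = inner ℝ (tang t) y → x = y := by
    intro x hx y hy hxy
    refine sub_eq_zero.1 (eq_zero_of_inner_dir_tang (t := t) ?_ ?_)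
    · rw [inner_sub_right, sub_eq_zero]
      exact le_antisymm (hy.2 _ hx.1) (hx.2 _ hy.1)
    · rw [inner_sub_right, hxy, sub_self]
  have h1 : p₂ = p + p' := by
    refine heq _ hp₂ _ hP (le_antisymm ?_ (hm₂ _ hP).2)
    obtain ⟨a, ha, b, hb, hab⟩ := supportSet_add_subset _ ⟨p, hp⟩ ⟨p', hp'⟩ hp₂
    rw [← hab, inner_add_right]
    simp only [inner_add_right]
    exact add_le_add (hm a ha).2 (hm' b hb).2
  have h2 : q₂ = q + q' := by
    refine heq _ hq₂ _ hQ (le_antisymm (hm₂ _ hQ).1 ?_)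
    obtain ⟨a, ha, b, hb, hab⟩ := supportSet_add_subset _ ⟨p, hp⟩ ⟨p', hp'⟩ hq₂
    rw [← hab, inner_add_right]
    simp only [inner_add_right]
    exact add_le_add (hm a ha).1 (hm' b hb).1
  rw [bdryFun_eq_midpoint hs, bdryFun_eq_midpoint hs', bdryFun_eq_midpoint hs₂, h1, h2]
  simp only [midpoint_eq_smul_add]
  module

/-- The order cancellation law for Minkowski addition. -/
lemma subset_of_add_eq_add (hϑ : 0 < ϑ) (hϑ' : ϑ ≤ Real.pi / 2) (hA : A ∈ CV (sector ϑ))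
    (hB : B ∈ CV (sector ϑ)) (hC : C ∈ CV (sector ϑ)) (h : A + C = B + C) : A ⊆ B := fun x hx =>
  mem_of_forall_exists_inner_dir_le hϑ hϑ' hB fun t ht => by
    have hH := bdryFun_add hϑ hϑ' hA hC ht
    rw [h, bdryFun_add hϑ hϑ' hB hC ht, add_left_inj] at hH
    exact ⟨_, (bdryFun_mem_supportSet hϑ hϑ' hB ht).1,
      hH ▸ (bdryFun_mem_supportSet hϑ hϑ' hA ht).2 x hx⟩

/-- No lengths are compared directly: the boundary functions satisfy the same equation, and a
tangential curve determines the increments of its function. -/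
lemma arcFun_add_eq (hϑ : 0 < ϑ) (hϑ' : ϑ ≤ Real.pi / 2) (hA : A ∈ CV (sector ϑ))
    (hB : B ∈ CV (sector ϑ)) (hC : C ∈ CV (sector ϑ)) (hD : D ∈ CV (sector ϑ))
    (h : A + D = B + C) {t : ℝ} (ht : t ∈ Ioo (-ϑ) ϑ) :
    arcFun A t + arcFun D t = arcFun B t + arcFun C t := by
  have hH : ∀ t ∈ Ioo (-ϑ) ϑ, bdryFun A t + bdryFun D t = bdryFun B t + bdryFun C t :=
    fun t ht => by rw [← bdryFun_add hϑ hϑ' hA hD ht, ← bdryFun_add hϑ hϑ' hB hC ht, h]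
  have := ((tangentialOn_bdryFun hϑ hϑ' hA).add (tangentialOn_bdryFun hϑ hϑ' hD)).fun_sub_eq_sub
    ((tangentialOn_bdryFun hϑ hϑ' hB).add (tangentialOn_bdryFun hϑ hϑ' hC))
    (fun s hs t ht => by rw [hH s hs, hH t ht]) (zero_mem_Ioo hϑ) ht
  simpa [(isNondecr_arcFun hϑ hϑ' hA).2, (isNondecr_arcFun hϑ hϑ' hB).2,
    (isNondecr_arcFun hϑ hϑ' hC).2, (isNondecr_arcFun hϑ hϑ' hD).2] using this

lemma genFun_add_eq {f₁ f₂ f₃ f₄ : ℝ → ℝ} (hϑ : 0 < ϑ) (h₁ : IsNondecr ϑ f₁) (h₂ : IsNondecr ϑ f₂)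
    (h₃ : IsNondecr ϑ f₃) (h₄ : IsNondecr ϑ f₄)
    (h : ∀ t ∈ Ioo (-ϑ) ϑ, f₁ t + f₂ t = f₃ t + f₄ t) {t : ℝ} (ht : t ∈ Ioo (-ϑ) ϑ) :
    genFun f₁ t + genFun f₂ t = genFun f₃ t + genFun f₄ t := by
  have := ((tangentialOn_genFun hϑ h₁).add (tangentialOn_genFun hϑ h₂)).sub_eq_sub
    ((tangentialOn_genFun hϑ h₃).add (tangentialOn_genFun hϑ h₄))
    (fun s hs t ht => by rw [h s hs, h t ht]) (zero_mem_Ioo hϑ) ht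
  simpa [genFun_zero hϑ h₁, genFun_zero hϑ h₂, genFun_zero hϑ h₃, genFun_zero hϑ h₄] using this

lemma genFun_const_zero (hϑ : 0 < ϑ) {t : ℝ} (ht : t ∈ Ioo (-ϑ) ϑ) :
    genFun (fun _ => 0) t = 0 := by
  have h0 : IsNondecr ϑ fun _ => 0 := ⟨monotoneOn_const, rfl⟩
  have h : TangentialOn ϑ (fun _ => 0) (fun _ => 0) (fun _ => 0) := by
    intro s _ t _ _
    simp
  simpa [genFun_zero hϑ h0] using
    (tangentialOn_genFun hϑ h0).sub_eq_sub h (fun _ _ _ _ => rfl) (zero_mem_Ioo hϑ) ht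

end
end PlanarPairs

/-! ### Balance equation and 0-minimality of the Jordan pair -/

open PlanarPairs in
theorem theorem4p4 (ϑ : ℝ) (hϑ : 0 < ϑ) (hϑ' : ϑ ≤ Real.pi / 2)
    (A B : Set PlanarPairs.Plane)
    (hA : A ∈ PlanarPairs.CV (PlanarPairs.sector ϑ))
    (hB : B ∈ PlanarPairs.CV (PlanarPairs.sector ϑ)) :
    (∃ h : ℝ → ℝ,
      PlanarPairs.IsInfimum ϑ (PlanarPairs.arcFun A) (PlanarPairs.arcFun B) h) ∧
    ∀ h : ℝ → ℝ,
      PlanarPairs.IsInfimum ϑ (PlanarPairs.arcFun A) (PlanarPairs.arcFun B) h →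
      ∀ gA gB : ℝ → ℝ,
        gA = (fun t => PlanarPairs.arcFun A t - h t) →
        gB = (fun t => PlanarPairs.arcFun B t - h t) →
        (PlanarPairs.IsNondecr ϑ gA ∧ PlanarPairs.IsMidvalued ϑ gA) ∧
        (PlanarPairs.IsNondecr ϑ gB ∧ PlanarPairs.IsMidvalued ϑ gB) ∧
        PlanarPairs.IsZeroMinimal (PlanarPairs.sector ϑ)
          (PlanarPairs.genSet ϑ gA + {PlanarPairs.bdryFun A 0 - PlanarPairs.bdryFun B 0})
          (PlanarPairs.genSet ϑ gB) ∧
        (PlanarPairs.genSet ϑ gA + {PlanarPairs.bdryFun A 0 - PlanarPairs.bdryFun B 0},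
          PlanarPairs.genSet ϑ gB) ∈ PlanarPairs.quotClass (PlanarPairs.sector ϑ) A B := by
  have hfA := isNondecr_arcFun hϑ hϑ' hA
  have hfB := isNondecr_arcFun hϑ hϑ' hB
  have h0I := zero_mem_Ioo hϑ
  refine ⟨⟨_, isInfimum_infFun hϑ hfA hfB⟩, ?_⟩
  intro h hh gA gB hgA hgB
  have hmid := hh.isMidvalued (isMidvalued_arcFun hϑ hϑ' hA) (isMidvalued_arcFun hϑ hϑ' hB)
  have nA : IsNondecr ϑ gA := by
    rw [hgA]; exact ⟨hh.1.2.1, by simp [hfA.2, hh.1.1.2]⟩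
  have nB : IsNondecr ϑ gB := by
    rw [hgB]; exact ⟨hh.1.2.2, by simp [hfB.2, hh.1.1.2]⟩
  have mA : IsMidvalued ϑ gA := by rw [hgA]; exact (isMidvalued_arcFun hϑ hϑ' hA).sub hmid
  have mB : IsMidvalued ϑ gB := by rw [hgB]; exact (isMidvalued_arcFun hϑ hϑ' hB).sub hmid
  set z := bdryFun A 0 - bdryFun B 0 with hz
  have hC := add_singleton_mem_CV (genSet_mem_CV hϑ hϑ' nA) z
  have hD := genSet_mem_CV hϑ hϑ' nB
  have hbal : ∀ t ∈ Ioo (-ϑ) ϑ,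
      bdryFun A t + genFun gB t = bdryFun B t + (genFun gA t + z) := fun t ht => by
    have h1 := genFun_add_eq hϑ hfA nB hfB nA (fun t _ => by rw [hgA, hgB]; ring) ht
    rw [bdryFun_eq hϑ hϑ' hA ht, bdryFun_eq hϑ hϑ' hB ht, hz, add_assoc, h1]
    abel
  have hCsup : ∀ t ∈ Ioo (-ϑ) ϑ, genFun gA t + z ∈ supportSet (genSet ϑ gA + {z}) (dir t) := by
    intro t ht
    refine ⟨add_mem_add (genFun_mem_genSet ht) rfl, ?_⟩
    rintro _ ⟨c, hc, _, rfl, rfl⟩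
    rw [inner_add_right, inner_add_right]
    linarith [inner_dir_le_of_mem_genSet hϑ hϑ' nA hc ht]
  have hDsup : ∀ t ∈ Ioo (-ϑ) ϑ, genFun gB t ∈ supportSet (genSet ϑ gB) (dir t) := fun t ht =>
    ⟨genFun_mem_genSet ht, fun d hd => inner_dir_le_of_mem_genSet hϑ hϑ' nB hd ht⟩
  have hADsup : ∀ t ∈ Ioo (-ϑ) ϑ,
      bdryFun A t + genFun gB t ∈ supportSet (A + genSet ϑ gB) (dir t) := fun t ht =>
    add_mem_supportSet (bdryFun_mem_supportSet hϑ hϑ' hA ht) (hDsup t ht)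
  have hBCsup : ∀ t ∈ Ioo (-ϑ) ϑ,
      bdryFun A t + genFun gB t ∈ supportSet (B + (genSet ϑ gA + {z})) (dir t) := fun t ht => by
    rw [hbal t ht]
    exact add_mem_supportSet (bdryFun_mem_supportSet hϑ hϑ' hB ht) (hCsup t ht)
  have hsum : A + genSet ϑ gB = B + (genSet ϑ gA + {z}) := by
    refine Subset.antisymm (fun x hx => ?_) fun x hx => ?_
    · exact mem_of_forall_exists_inner_dir_le hϑ hϑ' (add_mem_CV hϑ hϑ' hB hC) fun t ht =>
        ⟨_, (hBCsup t ht).1, (hADsup t ht).2 x hx⟩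
    · exact mem_of_forall_exists_inner_dir_le hϑ hϑ' (add_mem_CV hϑ hϑ' hA hD) fun t ht =>
        ⟨_, (hADsup t ht).1, (hBCsup t ht).2 x hx⟩
  have hquot : (genSet ϑ gA + {z}, genSet ϑ gB) ∈ quotClass (sector ϑ) A B :=
    ⟨hC, hD, congrArg closure hsum⟩
  refine ⟨⟨nA, mA⟩, ⟨nB, mB⟩, ⟨⟨⟨hC, hD, by rw [add_comm]⟩, zero_mem_genSet hϑ nB⟩, ?_⟩, hquot⟩
  rintro ⟨C', D'⟩ ⟨⟨hC', hD', hcl⟩, h0D⟩ ⟨-, hDD⟩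
  simp only at hC' hD' hcl h0D hDD
  rw [(isClosed_add_of_mem_CV hϑ hϑ' hC hD').closure_eq,
    (isClosed_add_of_mem_CV hϑ hϑ' hD hC').closure_eq] at hcl
  -- 0-minimality refers to the class of the pair itself; cancelling `A_{g_B}` moves the competitor
  -- into `[A, B]`.
  replace hcl : A + D' = B + C' := by
    have hAD := add_mem_CV hϑ hϑ' hA hD'
    have hBC := add_mem_CV hϑ hϑ' hB hC'
    have heq : A + D' + genSet ϑ gB = B + C' + genSet ϑ gB := by
      rw [add_right_comm, hsum, add_assoc, hcl, add_comm (genSet ϑ gB), add_assoc]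
    exact Subset.antisymm (subset_of_add_eq_add hϑ hϑ' hAD hBC hD heq)
      (subset_of_add_eq_add hϑ hϑ' hBC hAD hD heq.symm)
  have hfD := isNondecr_arcFun hϑ hϑ' hD'
  have hfC := isNondecr_arcFun hϑ hϑ' hC'
  have np : IsNondecr ϑ fun t => arcFun D' t - gB t := by
    refine ⟨?_, by simp [hfD.2, nB.2]⟩
    rw [hgB]
    exact hh.monotoneOn_sub hϑ hfA hfB hfC hfD fun t ht =>
      arcFun_add_eq hϑ hϑ' hA hB hC' hD' hcl ht
  set p := fun t => arcFun D' t - gB t with hp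
  set w := bdryFun D' 0 with hw
  have hD't : ∀ t ∈ Ioo (-ϑ) ϑ, bdryFun D' t = w + (genFun gB t + genFun p t) := fun t ht => by
    have h1 := genFun_add_eq hϑ hfD (f₂ := fun _ => 0) ⟨monotoneOn_const, rfl⟩ nB np
      (fun t _ => by rw [hp]; ring) ht
    rw [genFun_const_zero hϑ ht, add_zero] at h1
    rw [bdryFun_eq hϑ hϑ' hD' ht, h1]
  have hle : ∀ t ∈ Ioo (-ϑ) ϑ, inner ℝ (dir t) w + inner ℝ (dir t) (genFun p t) ≤ 0 := by
    intro t ht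
    have h1 := (hDsup t ht).2 _ (hDD (bdryFun_mem_supportSet hϑ hϑ' hD' ht).1)
    rw [hD't t ht, inner_add_right, inner_add_right] at h1
    linarith
  have hnn : ∀ t ∈ Ioo (-ϑ) ϑ, 0 ≤ inner ℝ (dir t) (genFun p t) := by
    intro t ht
    have h1 := (tangentialOn_genFun hϑ np).inner_dir_le hϑ' np.1 h0I ht
    rwa [genFun_zero hϑ np, inner_zero_right] at h1
  -- `0 ∈ D'` gives `w 0 ≥ 0` and direction `0` gives `w 0 ≤ 0`; the two opposite angles `±ϑ / 2`
  -- then bound `w 1` from both sides.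
  have hw0 : w = 0 := by
    have e0 : w 0 = 0 := by
      have h1 := (bdryFun_mem_supportSet hϑ hϑ' hD' h0I).2 _ h0D
      have h2 := hle 0 h0I
      have h3 := hnn 0 h0I
      rw [inner_dir_zero, inner_dir_zero] at h1
      rw [inner_dir_zero] at h2
      exact le_antisymm (by linarith) h1
    have ht1 : ϑ / 2 ∈ Ioo (-ϑ) ϑ := ⟨by linarith, by linarith⟩
    have ht2 : -(ϑ / 2) ∈ Ioo (-ϑ) ϑ := ⟨by linarith, by linarith⟩
    have e1 := (le_add_of_nonneg_right (hnn _ ht1)).trans (hle _ ht1)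
    have e2 := (le_add_of_nonneg_right (hnn _ ht2)).trans (hle _ ht2)
    have hsin := Real.sin_pos_of_pos_of_lt_pi (x := ϑ / 2) (by linarith) (by linarith)
    rw [inner_dir, e0, mul_zero, zero_add] at e1 e2
    rw [Real.sin_neg] at e2
    refine plane_ext e0 (le_antisymm ?_ ?_)
    · exact nonpos_of_mul_nonpos_right e1 hsin
    · exact nonneg_of_mul_nonneg_right (by linarith : 0 ≤ Real.sin (ϑ / 2) * w 1) hsin
  have hzero : ∀ t ∈ Ioo (-ϑ) ϑ, inner ℝ (dir t) (genFun p t) = 0 := fun t ht =>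
    le_antisymm (by simpa [hw0] using hle t ht) (hnn t ht)
  have hD'sup : ∀ t ∈ Ioo (-ϑ) ϑ,
      inner ℝ (dir t) (bdryFun D' t) = inner ℝ (dir t) (genFun gB t) := fun t ht => by
    rw [hD't t ht, hw0, zero_add, inner_add_right, hzero t ht, add_zero]
  refine ⟨fun x hx => ?_, fun x hx => ?_⟩
  -- The second components have equal support functions, so subtracting the two balance equations
  -- gives the same for the first.
  · refine mem_of_forall_exists_inner_dir_le hϑ hϑ' hC' fun t ht =>
      ⟨_, (bdryFun_mem_supportSet hϑ hϑ' hC' ht).1, ((hCsup t ht).2 x hx).trans (le_of_eq ?_)⟩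
    have h1 : bdryFun A t + bdryFun D' t = bdryFun B t + bdryFun C' t := by
      rw [← bdryFun_add hϑ hϑ' hA hD' ht, ← bdryFun_add hϑ hϑ' hB hC' ht, hcl]
    have h2 := congrArg (inner ℝ (dir t)) h1
    have h3 := congrArg (inner ℝ (dir t)) (hbal t ht)
    rw [inner_add_right, inner_add_right] at h2
    rw [inner_add_right, inner_add_right (dir t) (bdryFun B t)] at h3
    linarith [hD'sup t ht]
  · exact mem_of_forall_exists_inner_dir_le hϑ hϑ' hD' fun t ht =>
      ⟨_, (bdryFun_mem_supportSet hϑ hϑ' hD' ht).1,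
        ((hDsup t ht).2 x hx).trans (hD'sup t ht).ge⟩
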